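/- Let $G$ be a non-discrete locally compact (Hausdorff) group with left Haar measure $dx$, and let $\omega$ be a weight on $G$: a measurable function $\omega:G\to[0,\infty)$ with $\omega(e)=1$, $\omega(x^{-1})=\omega(x)$ and $\omega(xy)\le\omega(x)\omega(y)$ for all $x,y\in G$ (so that $\omega\ge1$). Let $1\le p<\infty$ and let $q\in(1,\infty]$ be the conjugate index, $\frac1p+\frac1q=1$. Suppose that there exist a bounded measurable function $u:G\to[0,\infty)$ and real numbers $s<q$ and $r>0$ such that $\omega u$ is bounded away from zero, $$\frac{\omega(xy)}{\omega(x)\omega(y)}\le u(x)+u(y)\quad(x,y\in G),\qquad\text{and}\qquad \int_G u(x)^s\,\omega(x)^r\,dx<\infty .$$ Let $A=L^p(G,\omega)\cap L^2(G)$, the space of (classes of) measurable functions $f:G\to\mathbb{C}$ with $f\in L^2(G)$ and $f\omega\in L^p(G)$, with the norm $\|f\|_A=\max\{\|f\omega\|_p,\|f\|_2\}$, and let $(f*g)(x)=\int_G f(y)\,g(y^{-1}x)\,dy$. Then $A$ is a Banach algebra under convolution, in the sense that it is complete, that $f*g$ is defined almost everywhere and belongs to $A$ for all $f,g\in A$,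 and that $\|f*g\|_A\le C\|f\|_A\|g\|_A$ for some constant $C$. Let $\widetilde A=A\times\mathbb{C}$ be its unitization, with the product $(f,t)(g,s)=(f*g+sf+tg,\,ts)$, the unit $(0,1)$ and the norm $\|(f,t)\|=\|f\|_A+|t|$. Then $$\Phi(f,t)\,g=f*g+t\,g\qquad(f\in A,\ t\in\mathbb{C},\ g\in L^2(G))$$ defines a continuous injective unital algebra homomorphism $\Phi:\widetilde A\to B(L^2(G))$, and $\Phi(\widetilde A)$ is inverse-closed in $B(L^2(G))$: if $a\in\widetilde A$ and $\Phi(a)$ is invertible in $B(L^2(G))$, then $\Phi(a)^{-1}\in\Phi(\widetilde A)$. -/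

import Mathlib

open MeasureTheory
open scoped ENNReal

/-- A weight on a group `G`: a measurable function `ω : G → [0, ∞)` with `ω 1 = 1` which is
symmetric and submultiplicative. -/
structure IsWeight {G : Type*} [Group G] [MeasurableSpace G] (ω : G → ℝ) : Prop where
  measurable : Measurable ω
  nonneg : ∀ x, 0 ≤ ω x
  map_one : ω 1 = 1
  map_inv : ∀ x, ω x⁻¹ = ω x
  map_mul_le : ∀ x y, ω (x * y) ≤ ω x * ω y

/-- The bound `1 ≤ ω` is automatic for weights. -/
theorem IsWeight.one_le {G : Type*} [Group G] [MeasurableSpace G] {ω : G → ℝ} (h : IsWeight ω)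
    (x : G) : 1 ≤ ω x := by
  have h1 := h.map_mul_le x x⁻¹
  rw [mul_inv_cancel, h.map_one, h.map_inv] at h1
  nlinarith [h.nonneg x]

/-- `h` is the convolution of `f` and `g` with respect to the (left Haar) measure `μ`: for almost
every `x` the convolution integral `∫ f(y) g(y⁻¹ x) dμ(y)` converges absolutely, and `h` is almost
everywhere equal to its value. -/
def IsConvolution {G : Type*} [Group G] [MeasurableSpace G] (μ : Measure G)
    (f g h : G → ℂ) : Prop :=
  (∀ᵐ x ∂μ, Integrable (fun y => f y * g (y⁻¹ * x)) μ) ∧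
    h =ᵐ[μ] fun x => ∫ y, f y * g (y⁻¹ * x) ∂μ

/-- The subspace `{f ∈ L²(μ) : f ω ∈ Lᵖ(μ)}` of `L²(μ)`. -/
def weightedSubmodule {G : Type*} [MeasurableSpace G] (ω : G → ℝ) (p : ℝ≥0∞) (μ : Measure G) :
    Submodule ℂ (Lp ℂ 2 μ) where
  carrier := {f | MemLp (fun x => f x * (ω x : ℂ)) p μ}
  zero_mem' := by
    refine (MemLp.zero' (ε := ℂ)).ae_eq ?_
    filter_upwards [Lp.coeFn_zero ℂ 2 μ] with x hx
    rw [hx, Pi.zero_apply, zero_mul]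
  add_mem' := by
    intro f g hf hg
    refine (MemLp.add hf hg).ae_eq ?_
    filter_upwards [Lp.coeFn_add f g] with x hx
    rw [hx, Pi.add_apply, Pi.add_apply, add_mul]
  smul_mem' := by
    intro c f hf
    refine (MemLp.const_smul hf c).ae_eq ?_
    filter_upwards [Lp.coeFn_smul c f] with x hx
    simp [hx, mul_assoc]

/-- The space `A = Lᵖ(G, ω) ∩ L²(G)`. This is a type of its own, because its norm is not the one
inherited from `L²(G)`. -/
def WeightedLpL2 {G : Type*} [MeasurableSpace G] (ω : G → ℝ) (p : ℝ≥0∞) (μ : Measure G) : Type _ :=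
  weightedSubmodule ω p μ

namespace WeightedLpL2

variable {G : Type*} [MeasurableSpace G] {ω : G → ℝ} {p : ℝ≥0∞} {μ : Measure G}

noncomputable instance : AddCommGroup (WeightedLpL2 ω p μ) :=
  inferInstanceAs (AddCommGroup (weightedSubmodule ω p μ))

noncomputable instance : Module ℂ (WeightedLpL2 ω p μ) :=
  inferInstanceAs (Module ℂ (weightedSubmodule ω p μ))

/-- The inclusion of `A` into `L²(G)`. -/
noncomputable def toL2 : WeightedLpL2 ω p μ →ₗ[ℂ] Lp ℂ 2 μ :=
  (weightedSubmodule ω p μ).subtype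

/-- The weighted norm `‖f‖_{p,ω} = ‖f ω‖_p` of `f ∈ A`. -/
noncomputable def weightedNorm (f : WeightedLpL2 ω p μ) : ℝ :=
  (eLpNorm (fun x => toL2 f x * (ω x : ℂ)) p μ).toReal

/-- The norm `‖f‖_A = max (‖f‖_{p,ω}, ‖f‖₂)`. -/
noncomputable instance : Norm (WeightedLpL2 ω p μ) where
  norm f := max (weightedNorm f) ‖toL2 f‖

theorem norm_def (f : WeightedLpL2 ω p μ) : ‖f‖ = max (weightedNorm f) ‖toL2 f‖ := rfl

theorem memLp (f : WeightedLpL2 ω p μ) : MemLp (fun x => toL2 f x * (ω x : ℂ)) p μ := f.2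

theorem toL2_injective : Function.Injective (toL2 : WeightedLpL2 ω p μ → Lp ℂ 2 μ) :=
  Subtype.val_injective

theorem weightedNorm_smul (c : ℂ) (f : WeightedLpL2 ω p μ) :
    weightedNorm (c • f) = ‖c‖ * weightedNorm f := by
  have h : (fun x => toL2 (c • f) x * (ω x : ℂ)) =ᵐ[μ]
      c • fun x => toL2 f x * (ω x : ℂ) := by
    rw [map_smul]
    filter_upwards [Lp.coeFn_smul c (toL2 f)] with x hx
    simp [hx, mul_assoc]
  unfold weightedNorm
  rw [eLpNorm_congr_ae h, eLpNorm_const_smul, ENNReal.toReal_mul, toReal_enorm]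

theorem weightedNorm_add_le [Fact (1 ≤ p)] (f g : WeightedLpL2 ω p μ) :
    weightedNorm (f + g) ≤ weightedNorm f + weightedNorm g := by
  have h : (fun x => toL2 (f + g) x * (ω x : ℂ)) =ᵐ[μ]
      (fun x => toL2 f x * (ω x : ℂ)) + fun x => toL2 g x * (ω x : ℂ) := by
    rw [map_add]
    filter_upwards [Lp.coeFn_add (toL2 f) (toL2 g)] with x hx
    rw [hx, Pi.add_apply, Pi.add_apply, add_mul]
  unfold weightedNorm
  rw [eLpNorm_congr_ae h, ← ENNReal.toReal_add f.memLp.2.ne g.memLp.2.ne]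
  exact ENNReal.toReal_mono (ENNReal.add_ne_top.2 ⟨f.memLp.2.ne, g.memLp.2.ne⟩)
    (eLpNorm_add_le f.memLp.1 g.memLp.1 Fact.out)

theorem normedSpaceCore [Fact (1 ≤ p)] : NormedSpace.Core ℂ (WeightedLpL2 ω p μ) where
  norm_nonneg f := (norm_nonneg (toL2 f)).trans (le_max_right _ _)
  norm_smul c f := by
    rw [norm_def, norm_def, weightedNorm_smul, map_smul, norm_smul,
      mul_max_of_nonneg _ _ (norm_nonneg c)]
  norm_triangle f g := by
    rw [norm_def, norm_def, norm_def, map_add]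
    refine max_le ((weightedNorm_add_le f g).trans ?_) ((norm_add_le _ _).trans ?_)
    · exact add_le_add (le_max_left _ _) (le_max_left _ _)
    · exact add_le_add (le_max_right _ _) (le_max_right _ _)
  norm_eq_zero_iff f := by
    constructor
    · intro h
      have h2 : ‖toL2 f‖ ≤ 0 := (le_max_right _ _).trans h.le
      exact toL2_injective ((norm_le_zero_iff.1 h2).trans (map_zero _).symm)
    · rintro rfl
      have h0 := weightedNorm_smul (0 : ℂ) (0 : WeightedLpL2 ω p μ)
      rw [zero_smul, norm_zero, zero_mul] at h0
      rw [norm_def, h0, map_zero, norm_zero, max_self]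

noncomputable instance [Fact (1 ≤ p)] : NormedAddCommGroup (WeightedLpL2 ω p μ) :=
  NormedAddCommGroup.ofCore normedSpaceCore

noncomputable instance [Fact (1 ≤ p)] : NormedSpace ℂ (WeightedLpL2 ω p μ) :=
  NormedSpace.ofCore normedSpaceCore

open Classical in
/-- The convolution product on `A`: `f * g` is the element of `A` that is the convolution of `f`
and `g`, if there is one (it is then unique), and `0` otherwise. -/
noncomputable instance [Group G] : Mul (WeightedLpL2 ω p μ) where
  mul f g :=
    if h : ∃ k : WeightedLpL2 ω p μ, IsConvolution μ (toL2 f) (toL2 g) (toL2 k) then h.choose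
    else 0

end WeightedLpL2

/-- The norm `‖(f, t)‖ = ‖f‖ + |t|` on the unitization `A × ℂ` of `A`. -/
noncomputable def unitizationNorm {A : Type*} [Norm A] (a : Unitization ℂ A) : ℝ :=
  ‖a.snd‖ + ‖a.fst‖

/-! Write λ(f) for left convolution by f on L². The engine is a differential inequality,
`norm_mul_self_le_rpow`: ‖f * f‖_A ≤ C ‖f‖_A^(2-θ) ‖f‖₂^θ for some 0 < θ < 1. Since ω(xy) ≤
ω(x)ω(y)(U(x) + U(y)) for a suitable U, Young's inequality bounds ‖(f * f)ω‖_p by 2 ‖fωU‖₁ ‖fω‖_p.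
The factor ‖fωU‖₁ is split at the level ω = R. Where ω ≥ R, Hölder applies and U has L^q norm
O(R^(-δ)). Where ω < R, Cauchy–Schwarz applies and the measure grows at most polynomially in R.
Optimising R gives the inequality.

Inverse-closedness: if X = Φ(a) is invertible, then Y = 1 - cXX* lies in the image of Φ and has norm
at most some l < 1 for a suitable c > 0. Write Y = λ(f) + t; as G is not discrete, |t| ≤ ‖Y‖. Then
Y^(2^k) = λ(H_k) + t^(2^k), and the L² norms satisfy ‖H_{k+1}‖₂ ≤ 2 l^(2^k) ‖H_k‖₂. The differential
inequality turns this into ‖H_k‖_A → 0 (`tendsto_zero_of_differential_inequality`). So 1 - Y^n has a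
right inverse in the algebra for some n, hence so do 1 - Y = cXX* and X.

Unimodularity is not assumed but forced (`modularCharacterFun_ge_one`). The modular function Δ is at
most C ω^s. If Δ is not trivial, approximate squaring of an element with small Δ squares Δ at each
step, while ω only grows to the power 2 - r/s. Hence log ω is o(2^k) along the iteration whereas
|log Δ| is at least of order 2^k, a contradiction.

G need not be second countable, so (y, x) ↦ g(y⁻¹x) may fail to be measurable for the product of the
Borel σ-algebras. The integrability assumption makes G σ-compact, and then every measurable function
agrees almost everywhere with a Baire function, for which this problem disappears. -/

open Filter Topology Function

set_option linter.unusedSectionVars false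

/-! ### Baire sets and measurability on products -/

/-- The σ-algebra of Baire sets: the smallest one for which all continuous real-valued functions
are measurable. -/
@[reducible] def baireSpace (X : Type*) [TopologicalSpace X] : MeasurableSpace X :=
  ⨆ f : C(X, ℝ), (borel ℝ).comap f

section Baire

variable {X Y Z : Type*} [TopologicalSpace X] [TopologicalSpace Y] [TopologicalSpace Z]

theorem baireSpace_le_borel [MeasurableSpace X] [BorelSpace X] :
    baireSpace X ≤ ‹MeasurableSpace X› := by
  refine iSup_le fun f => ?_
  rw [← measurable_iff_comap_le, ← BorelSpace.measurable_eq (α := ℝ)]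
  exact f.continuous.measurable

theorem measurable_baireSpace_of_continuous {f : X → ℝ} (hf : Continuous f) :
    Measurable[baireSpace X] f := by
  rw [measurable_iff_comap_le, BorelSpace.measurable_eq (α := ℝ)]
  exact le_iSup (fun f : C(X, ℝ) => (borel ℝ).comap f) ⟨f, hf⟩

theorem measurable_to_baireSpace {Y : Type*} [MeasurableSpace Y] {φ : Y → X}
    (h : ∀ f : X → ℝ, Continuous f → Measurable (f ∘ φ)) :
    @Measurable Y X _ (baireSpace X) φ := by
  rw [measurable_iff_comap_le, baireSpace, MeasurableSpace.comap_iSup]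
  refine iSup_le fun f => ?_
  rw [MeasurableSpace.comap_comp, ← BorelSpace.measurable_eq (α := ℝ), ← measurable_iff_comap_le]
  exact h f f.continuous

variable [MeasurableSpace X] [OpensMeasurableSpace X] [MeasurableSpace Y] [OpensMeasurableSpace Y]
  [LocallyCompactSpace X] [LocallyCompactSpace Y] [T2Space X] [T2Space Y] [SigmaCompactSpace X]
  [SigmaCompactSpace Y]

/-- A continuous function on a product of σ-compact locally compact spaces is measurable for the
product of the Borel σ-algebras, even if this is not the Borel σ-algebra of the product. -/
theorem Continuous.measurable_of_prod_sigmaCompact {F : X × Y → ℝ} (hF : Continuous F) :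
    Measurable F := by
  -- Compactly supported continuous functions are product-measurable; cutoffs equal to 1 along a
  -- compact exhaustion reduce to that case.
  let K := CompactExhaustion.choice (X × Y)
  choose χ hχ1 _ hχc _ using fun n => exists_continuous_one_zero_of_isCompact (K.isCompact n)
    isClosed_empty (Set.disjoint_empty _)
  refine measurable_of_tendsto_metrizable (f := fun n z => χ n z * F z) (fun n => ?_) ?_
  · exact HasCompactSupport.measurable_of_prod ((χ n).continuous.mul hF) (hχc n).mul_right
  · rw [tendsto_pi_nhds]
    intro z
    obtain ⟨N, hN⟩ := K.exists_mem z
    refine tendsto_const_nhds.congr' ?_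
    filter_upwards [eventually_ge_atTop N] with n hn
    rw [hχ1 n (K.subset hn hN), Pi.one_apply, one_mul]

theorem Continuous.measurable_prod_baireSpace {φ : X × Y → Z} (hφ : Continuous φ) :
    @Measurable (X × Y) Z _ (baireSpace Z) φ :=
  measurable_to_baireSpace fun _ hf => (hf.comp hφ).measurable_of_prod_sigmaCompact

end Baire

section BaireAE

variable {X : Type*} [TopologicalSpace X] [MeasurableSpace X] [BorelSpace X]
  [LocallyCompactSpace X] [T2Space X] [SigmaCompactSpace X] (μ : Measure X) [μ.Regular]

/-- Inner regularity gives compact K ⊆ U of nearly full measure, and Urysohn's lemma a cozero set,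
which is Baire, between K and U. A countable union of these exhausts U up to a null set. -/
theorem exists_baire_ae_eq_of_isOpen_of_lt_top {U : Set X} (hU : IsOpen U) (hfin : μ U < ∞) :
    ∃ B, MeasurableSet[baireSpace X] B ∧ B =ᵐ[μ] U := by
  have h : ∀ n : ℕ, ∃ B, MeasurableSet[baireSpace X] B ∧ B ⊆ U ∧ μ (U \ B) ≤ (n + 1 : ℝ≥0∞)⁻¹ := by
    intro n
    rcases eq_or_ne (μ U) 0 with h0 | h0
    · exact ⟨∅, @MeasurableSet.empty X (baireSpace X), Set.empty_subset _, by simp [h0]⟩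
    have hlt : μ U - (n + 1 : ℝ≥0∞)⁻¹ < μ U :=
      ENNReal.sub_lt_self hfin.ne h0 (by simp)
    obtain ⟨K, hKU, hK, hμ⟩ := hU.exists_lt_isCompact hlt
    obtain ⟨χ, h1, h2, -, -⟩ := exists_continuous_one_zero_of_isCompact hK hU.isClosed_compl
      (Set.disjoint_compl_right_iff_subset.2 hKU)
    refine ⟨χ ⁻¹' {0}ᶜ, ?_, ?_, ?_⟩
    · exact measurable_baireSpace_of_continuous χ.continuous (measurableSet_singleton 0).compl
    · intro x hx
      by_contra hxU
      exact hx (h2 hxU)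
    · calc μ (U \ χ ⁻¹' {0}ᶜ) ≤ μ (U \ K) := by
            refine measure_mono (Set.sdiff_subset_sdiff_right fun x hx => ?_)
            simp [h1 hx]
        _ = μ U - μ K := measure_sdiff hKU hK.measurableSet.nullMeasurableSet hK.measure_lt_top.ne
        _ ≤ _ := by
            rw [tsub_le_iff_left]
            exact (tsub_le_iff_right.1 hμ.le)
  choose B hB hBU hμ using h
  refine ⟨⋃ n, B n, MeasurableSet.iUnion hB, ?_⟩
  have hsub : (⋃ n, B n) ⊆ U := Set.iUnion_subset hBU
  refine Filter.EventuallyLE.antisymm hsub.eventuallyLE ?_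
  rw [ae_le_set]
  have : ∀ n : ℕ, μ (U \ ⋃ n, B n) ≤ (n + 1 : ℝ≥0∞)⁻¹ := fun n =>
    (measure_mono (Set.sdiff_subset_sdiff_right (Set.subset_iUnion B n))).trans (hμ n)
  have h2 : Tendsto (fun n : ℕ => (n + 1 : ℝ≥0∞)⁻¹) atTop (𝓝 0) := by
    have := (tendsto_add_atTop_iff_nat 1).2 ENNReal.tendsto_inv_nat_nhds_zero
    simpa using this
  exact le_antisymm (ge_of_tendsto' h2 this) bot_le

theorem exists_baire_ae_eq_of_isOpen {U : Set X} (hU : IsOpen U) :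
    ∃ B, MeasurableSet[baireSpace X] B ∧ B =ᵐ[μ] U := by
  let K := CompactExhaustion.choice X
  choose B hB hBU using fun n => exists_baire_ae_eq_of_isOpen_of_lt_top
    μ (hU.inter (isOpen_interior (s := K n))) ((measure_mono (Set.inter_subset_right.trans interior_subset)).trans_lt
      (K.isCompact n).measure_lt_top)
  refine ⟨⋃ n, B n, MeasurableSet.iUnion hB, ?_⟩
  have : U = ⋃ n, U ∩ interior (K n) := by
    rw [← Set.inter_iUnion, eq_comm, Set.inter_eq_left]
    intro x _
    obtain ⟨n, hn⟩ := K.exists_mem x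
    exact Set.mem_iUnion.2 ⟨n + 1, K.subset_interior_succ n hn⟩
  rw [this]
  exact Filter.EventuallyEq.countable_iUnion hBU

/-- Sets almost everywhere equal to a Baire set form a σ-algebra, so it suffices to treat open sets.
-/
theorem MeasurableSet.exists_baire_ae_eq {s : Set X} (hs : MeasurableSet s) :
    ∃ B, MeasurableSet[baireSpace X] B ∧ B =ᵐ[μ] s := by
  have hle : ‹MeasurableSpace X› ≤ eventuallyMeasurableSpace (baireSpace X) (ae μ) := by
    refine (BorelSpace.measurable_eq (α := X)).le.trans (MeasurableSpace.generateFrom_le fun U hU => ?_)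
    obtain ⟨B, hB, hBU⟩ := exists_baire_ae_eq_of_isOpen μ hU
    exact ⟨B, hB, hBU.symm⟩
  obtain ⟨B, hB, hBU⟩ := hle s hs
  exact ⟨B, hB, hBU.symm⟩

theorem Measurable.exists_baire_ae_eq_ennreal {f : X → ℝ≥0∞} (hf : Measurable f) :
    ∃ g, Measurable[baireSpace X] g ∧ g =ᵐ[μ] f := by
  refine Measurable.ennreal_induction (motive := fun f => ∃ g, Measurable[baireSpace X] g ∧ g =ᵐ[μ] f)
    ?_ ?_ ?_ hf
  · intro c s hs
    obtain ⟨B, hB, hBs⟩ := hs.exists_baire_ae_eq μ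
    exact ⟨B.indicator fun _ => c, Measurable.indicator (@measurable_const _ _ _ (_) c) hB,
      indicator_ae_eq_of_ae_eq_set hBs⟩
  · intro f g _ _ _ ihf ihg
    obtain ⟨f', hf', hff⟩ := ihf
    obtain ⟨g', hg', hgg⟩ := ihg
    exact ⟨f' + g', Measurable.add hf' hg', hff.add hgg⟩
  · intro f _ _ ih
    choose f' hf' hff using ih
    refine ⟨fun x => ⨆ n, f' n x, Measurable.iSup hf', ?_⟩
    filter_upwards [ae_all_iff.2 hff] with x hx
    simp [hx]

theorem AEMeasurable.exists_baire_ae_eq_ennreal {f : X → ℝ≥0∞} (hf : AEMeasurable f μ) :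
    ∃ g, Measurable[baireSpace X] g ∧ f =ᵐ[μ] g := by
  obtain ⟨g, hg, hgf⟩ := hf.measurable_mk.exists_baire_ae_eq_ennreal μ
  exact ⟨g, hg, hf.ae_eq_mk.trans hgf.symm⟩

theorem AEMeasurable.exists_baire_ae_eq_real {f : X → ℝ} (hf : AEMeasurable f μ) :
    ∃ g, Measurable[baireSpace X] g ∧ f =ᵐ[μ] g := by
  obtain ⟨g, hg, hfg⟩ := AEMeasurable.exists_baire_ae_eq_ennreal μ hf.ennreal_ofReal
  obtain ⟨k, hk, hfk⟩ := AEMeasurable.exists_baire_ae_eq_ennreal μ hf.neg.ennreal_ofReal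
  refine ⟨fun x => (g x).toReal - (k x).toReal, Measurable.sub hg.ennreal_toReal
    hk.ennreal_toReal, ?_⟩
  filter_upwards [hfg, hfk] with x h1 h2
  rw [← h1, ← h2, ENNReal.toReal_ofReal', ENNReal.toReal_ofReal']
  exact (max_zero_sub_max_neg_zero_eq_self (f x)).symm

theorem AEMeasurable.exists_baire_ae_eq_complex {f : X → ℂ} (hf : AEMeasurable f μ) :
    ∃ g, Measurable[baireSpace X] g ∧ f =ᵐ[μ] g := by
  obtain ⟨g, hg, hfg⟩ := AEMeasurable.exists_baire_ae_eq_real μ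
    (Complex.measurable_re.comp_aemeasurable hf)
  obtain ⟨k, hk, hfk⟩ := AEMeasurable.exists_baire_ae_eq_real μ
    (Complex.measurable_im.comp_aemeasurable hf)
  refine ⟨fun x => (g x : ℂ) + (k x : ℂ) * Complex.I, ?_, ?_⟩
  · exact Measurable.add (Complex.measurable_ofReal.comp hg)
      (Measurable.mul_const (Complex.measurable_ofReal.comp hk) _)
  · filter_upwards [hfg, hfk] with x h1 h2
    rw [← h1, ← h2]
    exact (Complex.re_add_im (f x)).symm

end BaireAE

/-! ### Convolution of nonnegative functions and Young's inequality -/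

section Convolution

variable {G : Type*} [Group G] [TopologicalSpace G] [IsTopologicalGroup G]
  [LocallyCompactSpace G] [T2Space G] [SigmaCompactSpace G] [MeasurableSpace G] [BorelSpace G]
  (μ : Measure G) [μ.IsHaarMeasure] [μ.Regular] [μ.IsInvInvariant]

theorem measurePreserving_inv_mul_const (x : G) : MeasurePreserving (fun y => y⁻¹ * x) μ μ := by
  have := (Measure.measurePreserving_inv μ).comp (measurePreserving_mul_left μ x⁻¹)
  convert this using 2 with y
  simp

theorem ae_eq_comp_inv_mul_const {E : Type*} {g g' : G → E} (h : g =ᵐ[μ] g') (x : G) :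
    (fun y => g (y⁻¹ * x)) =ᵐ[μ] fun y => g' (y⁻¹ * x) :=
  (measurePreserving_inv_mul_const μ x).quasiMeasurePreserving.ae_eq_comp h

/-- This is the gain from Baire functions: the group operations are measurable from the product of
the Borel σ-algebras to the Baire σ-algebra, which allows Tonelli and Fubini. -/
theorem measurable_comp_inv_mul_of_baire {E : Type*} [MeasurableSpace E] {H : G → E}
    (hH : Measurable[baireSpace G] H) : Measurable fun z : G × G => H (z.1⁻¹ * z.2) :=
  hH.comp (Continuous.measurable_prod_baireSpace
    (φ := fun z : G × G => z.1⁻¹ * z.2) (by fun_prop))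

theorem measurable_of_baire {E : Type*} [MeasurableSpace E] {H : G → E}
    (hH : Measurable[baireSpace G] H) : Measurable H :=
  hH.mono baireSpace_le_borel le_rfl

theorem mlconvolution_apply (F H : G → ℝ≥0∞) (x : G) :
    mlconvolution F H μ x = ∫⁻ y, F y * H (y⁻¹ * x) ∂μ := rfl

theorem mlconvolution_congr {F F' H H' : G → ℝ≥0∞} (hF : F =ᵐ[μ] F') (hH : H =ᵐ[μ] H') :
    mlconvolution F H μ = mlconvolution F' H' μ := by
  ext x
  refine lintegral_congr_ae ?_
  filter_upwards [hF, ae_eq_comp_inv_mul_const μ hH x] with y h1 h2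
  rw [h1, h2]

theorem measurable_mlconvolution {F H : G → ℝ≥0∞} (hF : AEMeasurable F μ) (hH : AEMeasurable H μ) :
    Measurable (mlconvolution F H μ) := by
  obtain ⟨F', hF', hFF⟩ := hF.exists_baire_ae_eq_ennreal μ
  obtain ⟨H', hH', hHH⟩ := hH.exists_baire_ae_eq_ennreal μ
  rw [mlconvolution_congr μ hFF hHH]
  exact Measurable.lintegral_prod_left'
    (((measurable_of_baire hF').comp measurable_fst).mul (measurable_comp_inv_mul_of_baire hH'))

theorem lintegral_mlconvolution {F H : G → ℝ≥0∞} (hF : AEMeasurable F μ) (hH : AEMeasurable H μ) :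
    ∫⁻ x, mlconvolution F H μ x ∂μ = (∫⁻ x, F x ∂μ) * ∫⁻ x, H x ∂μ := by
  obtain ⟨F', hF', hFF⟩ := hF.exists_baire_ae_eq_ennreal μ
  obtain ⟨H', hH', hHH⟩ := hH.exists_baire_ae_eq_ennreal μ
  rw [mlconvolution_congr μ hFF hHH, lintegral_congr_ae hFF, lintegral_congr_ae hHH]
  simp only [mlconvolution_apply]
  rw [lintegral_lintegral_swap]
  · have : ∀ y, ∫⁻ x, F' y * H' (y⁻¹ * x) ∂μ = F' y * ∫⁻ x, H' x ∂μ := fun y => by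
      have hm : Measurable fun x => H' (y⁻¹ * x) :=
        (measurable_of_baire hH').comp (measurable_const_mul _)
      rw [lintegral_const_mul _ hm, lintegral_mul_left_eq_self]
    simp only [this]
    rw [lintegral_mul_const _ (measurable_of_baire hF')]
  · have : Measurable fun z : G × G => F' z.1 * H' (z.1⁻¹ * z.2) :=
      ((measurable_of_baire hF').comp measurable_fst).mul (measurable_comp_inv_mul_of_baire hH')
    exact (this.comp measurable_swap).aemeasurable

/-- Jensen's inequality for the measure F dν, obtained from Hölder by writing F = F^(1/p) F^(1/p')
with p' the conjugate exponent. -/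
theorem lintegral_mul_rpow_le {α : Type*} [MeasurableSpace α] {ν : Measure α} {F H : α → ℝ≥0∞}
    (hF : AEMeasurable F ν) (hH : AEMeasurable H ν) {p : ℝ} (hp : 1 ≤ p) :
    (∫⁻ y, F y * H y ∂ν) ^ p ≤ (∫⁻ y, F y ∂ν) ^ (p - 1) * ∫⁻ y, F y * H y ^ p ∂ν := by
  rcases hp.eq_or_lt with rfl | hp
  · simp
  have hpq : p.HolderConjugate (p / (p - 1)) := Real.HolderConjugate.conjExponent hp
  have h0 : 0 < p := by linarith
  have h1 := ENNReal.lintegral_mul_le_Lp_mul_Lq ν hpq (f := fun y => F y ^ p⁻¹ * H y)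
    (g := fun y => F y ^ (p / (p - 1))⁻¹) ((hF.pow_const _).mul hH) (hF.pow_const _)
  have h2 : ∀ y, ((fun y => F y ^ p⁻¹ * H y) * fun y => F y ^ (p / (p - 1))⁻¹) y = F y * H y := by
    intro y
    simp only [Pi.mul_apply]
    rw [mul_right_comm, ← ENNReal.rpow_add_of_nonneg _ _ (by positivity)
      (by have := hpq.symm.pos; positivity), hpq.inv_add_inv_eq_one, ENNReal.rpow_one]
  simp only [h2] at h1
  have h3 : ∀ y, (F y ^ p⁻¹ * H y) ^ p = F y * H y ^ p := fun y => by
    rw [ENNReal.mul_rpow_of_nonneg _ _ h0.le, ENNReal.rpow_inv_rpow h0.ne']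
  have h4 : ∀ y, (F y ^ (p / (p - 1))⁻¹) ^ (p / (p - 1)) = F y := fun y =>
    ENNReal.rpow_inv_rpow hpq.symm.pos.ne' _
  simp only [h3, h4] at h1
  calc (∫⁻ y, F y * H y ∂ν) ^ p ≤ _ := ENNReal.rpow_le_rpow h1 h0.le
    _ = _ := by
      rw [ENNReal.mul_rpow_of_nonneg _ _ h0.le, ← ENNReal.rpow_mul, ← ENNReal.rpow_mul, mul_comm]
      congr 2
      · have : p - 1 ≠ 0 := by linarith
        field_simp
      · rw [one_div, inv_mul_cancel₀ h0.ne', ENNReal.rpow_one]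

/-- The Jensen-type bound is applied at each x; the remaining convolution of F with H^p is
integrated by Tonelli. -/
theorem lintegral_mlconvolution_rpow_le {F H : G → ℝ≥0∞} (hF : AEMeasurable F μ)
    (hH : AEMeasurable H μ) {p : ℝ} (hp : 1 ≤ p) :
    ∫⁻ x, mlconvolution F H μ x ^ p ∂μ ≤ (∫⁻ x, F x ∂μ) ^ p * ∫⁻ x, H x ^ p ∂μ := by
  calc ∫⁻ x, mlconvolution F H μ x ^ p ∂μ
      ≤ ∫⁻ x, (∫⁻ x, F x ∂μ) ^ (p - 1) * mlconvolution F (fun y => H y ^ p) μ x ∂μ :=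
        lintegral_mono fun x => lintegral_mul_rpow_le hF
          (hH.comp_quasiMeasurePreserving
            (measurePreserving_inv_mul_const μ x).quasiMeasurePreserving) hp
    _ = _ := by
      rw [lintegral_const_mul _ (measurable_mlconvolution μ hF (hH.pow_const p)),
        lintegral_mlconvolution μ hF (hH.pow_const p), ← mul_assoc]
      congr 1
      nth_rw 2 [← ENNReal.rpow_one (∫⁻ x, F x ∂μ)]
      rw [← ENNReal.rpow_add_of_nonneg _ _ (by linarith) zero_le_one, sub_add_cancel]

theorem eLpNorm_mlconvolution_le {F H : G → ℝ≥0∞} (hF : AEMeasurable F μ) (hH : AEMeasurable H μ)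
    {p : ℝ≥0∞} (hp : 1 ≤ p) (hp' : p ≠ ∞) :
    eLpNorm (mlconvolution F H μ) p μ ≤ (∫⁻ x, F x ∂μ) * eLpNorm H p μ := by
  have hp0 : p ≠ 0 := (zero_lt_one.trans_le hp).ne'
  have hr : 1 ≤ p.toReal := by
    rw [← ENNReal.toReal_one]; exact ENNReal.toReal_mono hp' hp
  rw [eLpNorm_eq_lintegral_rpow_enorm_toReal hp0 hp', eLpNorm_eq_lintegral_rpow_enorm_toReal hp0 hp']
  simp only [enorm_eq_self]
  have := ENNReal.rpow_le_rpow (lintegral_mlconvolution_rpow_le μ hF hH hr)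
    (z := 1 / p.toReal) (by positivity)
  rwa [ENNReal.mul_rpow_of_nonneg _ _ (by positivity), one_div, ENNReal.rpow_rpow_inv
    (by linarith), ← one_div] at this

theorem mlconvolution_inv (F H : G → ℝ≥0∞) (x : G) :
    mlconvolution F H μ x⁻¹ = mlconvolution (fun y => H y⁻¹) (fun y => F y⁻¹) μ x := by
  rw [mlconvolution_apply, mlconvolution_apply,
    ← lintegral_mul_left_eq_self (fun y => H y⁻¹ * F (y⁻¹ * x)⁻¹) x]
  refine lintegral_congr fun y => ?_
  simp [mul_comm]

theorem eLpNorm_comp_inv {E : Type*} [TopologicalSpace E] [ContinuousENorm E] {f : G → E}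
    (hf : AEStronglyMeasurable f μ) (p : ℝ≥0∞) :
    eLpNorm (fun x => f x⁻¹) p μ = eLpNorm f p μ :=
  eLpNorm_comp_measurePreserving hf (Measure.measurePreserving_inv μ)

/-- Inversion preserves μ and exchanges the two factors, so this is the other half of Young's
inequality read through x ↦ x⁻¹. -/
theorem eLpNorm_mlconvolution_le' {F H : G → ℝ≥0∞} (hF : AEMeasurable F μ) (hH : AEMeasurable H μ)
    {p : ℝ≥0∞} (hp : 1 ≤ p) (hp' : p ≠ ∞) :
    eLpNorm (mlconvolution F H μ) p μ ≤ eLpNorm F p μ * (∫⁻ x, H x ∂μ) := by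
  have hq := (Measure.measurePreserving_inv μ).quasiMeasurePreserving
  have h1 := eLpNorm_mlconvolution_le μ (hH.comp_quasiMeasurePreserving hq)
    (hF.comp_quasiMeasurePreserving hq) hp hp'
  have h2 : mlconvolution (H ∘ Inv.inv) (F ∘ Inv.inv) μ = fun x => mlconvolution F H μ x⁻¹ :=
    funext fun x => (mlconvolution_inv μ F H x).symm
  rw [h2, eLpNorm_comp_inv μ (measurable_mlconvolution μ hF hH).aestronglyMeasurable] at h1
  have h3 : eLpNorm (F ∘ Inv.inv) p μ = eLpNorm F p μ :=
    eLpNorm_comp_inv μ hF.aestronglyMeasurable p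
  have h4 : ∫⁻ x, (H ∘ Inv.inv) x ∂μ = ∫⁻ x, H x ∂μ := lintegral_inv_eq_self H
  rwa [h3, h4, mul_comm] at h1

end Convolution

/-! ### Convolution of complex functions: integrability, associativity, involution -/

section ComplexConvolution

variable {G : Type*} [Group G] [TopologicalSpace G] [IsTopologicalGroup G]
  [LocallyCompactSpace G] [T2Space G] [SigmaCompactSpace G] [MeasurableSpace G] [BorelSpace G]
  (μ : Measure G) [μ.IsHaarMeasure] [μ.Regular] [μ.IsInvInvariant]

/-- The convolution `(f * g)(x) = ∫ f(y) g(y⁻¹ x) dμ(y)` of complex functions on a group. -/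
noncomputable def groupConv (f g : G → ℂ) (x : G) : ℂ := ∫ y, f y * g (y⁻¹ * x) ∂μ

/-- Equality holds at every x, because y ↦ y⁻¹x preserves μ for each x. Passing to Baire
representatives therefore costs nothing. -/
theorem groupConv_congr {f f' g g' : G → ℂ} (hf : f =ᵐ[μ] f') (hg : g =ᵐ[μ] g') :
    groupConv μ f g = groupConv μ f' g' := by
  ext x
  refine integral_congr_ae ?_
  filter_upwards [hf, ae_eq_comp_inv_mul_const μ hg x] with y h1 h2
  rw [h1, h2]

theorem stronglyMeasurable_groupConv {f g : G → ℂ} (hf : AEStronglyMeasurable f μ)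
    (hg : AEStronglyMeasurable g μ) : StronglyMeasurable (groupConv μ f g) := by
  obtain ⟨f', hf', hff⟩ := hf.aemeasurable.exists_baire_ae_eq_complex μ
  obtain ⟨g', hg', hgg⟩ := hg.aemeasurable.exists_baire_ae_eq_complex μ
  rw [groupConv_congr μ hff hgg]
  have : Measurable fun z : G × G => f' z.1 * g' (z.1⁻¹ * z.2) :=
    ((measurable_of_baire hf').comp measurable_fst).mul (measurable_comp_inv_mul_of_baire hg')
  exact StronglyMeasurable.integral_prod_right (f := fun x y => f' y * g' (y⁻¹ * x))
    (this.comp measurable_swap).stronglyMeasurable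

theorem enorm_groupConv_le (f g : G → ℂ) (x : G) :
    ‖groupConv μ f g x‖ₑ ≤ mlconvolution (fun y => ‖f y‖ₑ) (fun y => ‖g y‖ₑ) μ x := by
  refine (enorm_integral_le_lintegral_enorm _).trans_eq ?_
  simp only [enorm_mul]
  rfl

theorem integrable_of_mlconvolution_lt_top {f g : G → ℂ} (hf : AEStronglyMeasurable f μ)
    (hg : AEStronglyMeasurable g μ) {x : G}
    (h : mlconvolution (fun y => ‖f y‖ₑ) (fun y => ‖g y‖ₑ) μ x < ∞) :
    Integrable (fun y => f y * g (y⁻¹ * x)) μ := by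
  refine ⟨hf.mul (hg.comp_quasiMeasurePreserving
    (measurePreserving_inv_mul_const μ x).quasiMeasurePreserving), ?_⟩
  rw [hasFiniteIntegral_iff_enorm]
  simp only [enorm_mul]
  exact h

theorem eLpNorm_enorm_eq {α : Type*} [MeasurableSpace α] {ν : Measure α} (f : α → ℂ) (p : ℝ≥0∞) :
    eLpNorm (fun x => ‖f x‖ₑ) p ν = eLpNorm f p ν :=
  eLpNorm_congr_enorm_ae (Eventually.of_forall fun _ => enorm_eq_self _)

theorem eLpNorm_mlconvolution_enorm_le {f g : G → ℂ} (hf : AEStronglyMeasurable f μ)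
    (hg : AEStronglyMeasurable g μ) {p : ℝ≥0∞} (hp : 1 ≤ p) (hp' : p ≠ ∞) :
    eLpNorm (mlconvolution (fun y => ‖f y‖ₑ) (fun y => ‖g y‖ₑ) μ) p μ
      ≤ eLpNorm f 1 μ * eLpNorm g p μ := by
  rw [eLpNorm_one_eq_lintegral_enorm, ← eLpNorm_enorm_eq g]
  exact eLpNorm_mlconvolution_le μ hf.enorm hg.enorm hp hp'

theorem eLpNorm_mlconvolution_enorm_le' {f g : G → ℂ} (hf : AEStronglyMeasurable f μ)
    (hg : AEStronglyMeasurable g μ) {p : ℝ≥0∞} (hp : 1 ≤ p) (hp' : p ≠ ∞) :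
    eLpNorm (mlconvolution (fun y => ‖f y‖ₑ) (fun y => ‖g y‖ₑ) μ) p μ
      ≤ eLpNorm f p μ * eLpNorm g 1 μ := by
  rw [eLpNorm_one_eq_lintegral_enorm, ← eLpNorm_enorm_eq f]
  exact eLpNorm_mlconvolution_le' μ hf.enorm hg.enorm hp hp'

theorem eLpNorm_groupConv_le {f g : G → ℂ} (hf : AEStronglyMeasurable f μ)
    (hg : AEStronglyMeasurable g μ) {p : ℝ≥0∞} (hp : 1 ≤ p) (hp' : p ≠ ∞) :
    eLpNorm (groupConv μ f g) p μ ≤ eLpNorm f 1 μ * eLpNorm g p μ :=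
  (eLpNorm_mono_enorm fun x => by
    simpa using enorm_groupConv_le μ f g x).trans (eLpNorm_mlconvolution_enorm_le μ hf hg hp hp')

theorem eLpNorm_groupConv_le' {f g : G → ℂ} (hf : AEStronglyMeasurable f μ)
    (hg : AEStronglyMeasurable g μ) {p : ℝ≥0∞} (hp : 1 ≤ p) (hp' : p ≠ ∞) :
    eLpNorm (groupConv μ f g) p μ ≤ eLpNorm f p μ * eLpNorm g 1 μ :=
  (eLpNorm_mono_enorm fun x => by
    simpa using enorm_groupConv_le μ f g x).trans (eLpNorm_mlconvolution_enorm_le' μ hf hg hp hp')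

theorem ae_lt_top_of_eLpNorm_lt_top {α : Type*} [MeasurableSpace α] {ν : Measure α}
    {F : α → ℝ≥0∞} (hF : Measurable F) {p : ℝ≥0∞} (hp : 1 ≤ p) (hp' : p ≠ ∞)
    (h : eLpNorm F p ν < ∞) : ∀ᵐ x ∂ν, F x < ∞ := by
  have hp0 : p ≠ 0 := (zero_lt_one.trans_le hp).ne'
  have h1 := lintegral_rpow_enorm_lt_top_of_eLpNorm_lt_top hp0 hp' h
  filter_upwards [ae_lt_top (hF.enorm.pow_const _) h1.ne] with x hx
  rw [enorm_eq_self] at hx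
  exact (ENNReal.rpow_lt_top_iff_of_pos (ENNReal.toReal_pos hp0 hp')).1 hx

theorem ae_mlconvolution_lt_top {f g : G → ℂ} (hf : MemLp f 1 μ)
    {p : ℝ≥0∞} (hp : 1 ≤ p) (hp' : p ≠ ∞) (hg : MemLp g p μ) :
    ∀ᵐ x ∂μ, mlconvolution (fun y => ‖f y‖ₑ) (fun y => ‖g y‖ₑ) μ x < ∞ :=
  ae_lt_top_of_eLpNorm_lt_top (measurable_mlconvolution μ hf.1.enorm hg.1.enorm) hp hp'
    ((eLpNorm_mlconvolution_enorm_le μ hf.1 hg.1 hp hp').trans_lt (ENNReal.mul_lt_top hf.2 hg.2))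

theorem memLp_groupConv {f g : G → ℂ} (hf : MemLp f 1 μ)
    {p : ℝ≥0∞} (hp : 1 ≤ p) (hp' : p ≠ ∞) (hg : MemLp g p μ) : MemLp (groupConv μ f g) p μ :=
  ⟨(stronglyMeasurable_groupConv μ hf.1 hg.1).aestronglyMeasurable,
    (eLpNorm_groupConv_le μ hf.1 hg.1 hp hp').trans_lt (ENNReal.mul_lt_top hf.2 hg.2)⟩

theorem isConvolution_groupConv {f g : G → ℂ} (hf : MemLp f 1 μ)
    {p : ℝ≥0∞} (hp : 1 ≤ p) (hp' : p ≠ ∞) (hg : MemLp g p μ) :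
    IsConvolution μ f g (groupConv μ f g) := by
  refine ⟨?_, ae_eq_refl _⟩
  filter_upwards [ae_mlconvolution_lt_top μ hf hp hp' hg] with x hx
  exact integrable_of_mlconvolution_lt_top μ hf.1 hg.1 hx

/-- The finiteness hypothesis is absolute integrability of the double integral at x, so Fubini
applies, followed by a left translation of the inner variable. -/
theorem groupConv_assoc_apply {f g k : G → ℂ} (hf : AEStronglyMeasurable f μ)
    (hg : AEStronglyMeasurable g μ) (hk : AEStronglyMeasurable k μ) {x : G}
    (h : mlconvolution (mlconvolution (fun y => ‖f y‖ₑ) (fun y => ‖g y‖ₑ) μ) (fun y => ‖k y‖ₑ) μ x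
      < ∞) :
    groupConv μ (groupConv μ f g) k x = groupConv μ f (groupConv μ g k) x := by
  obtain ⟨f', hf', hff⟩ := hf.aemeasurable.exists_baire_ae_eq_complex μ
  obtain ⟨g', hg', hgg⟩ := hg.aemeasurable.exists_baire_ae_eq_complex μ
  obtain ⟨k', hk', hkk⟩ := hk.aemeasurable.exists_baire_ae_eq_complex μ
  have hff' : (fun y => ‖f y‖ₑ) =ᵐ[μ] fun y => ‖f' y‖ₑ := hff.fun_comp enorm
  have hgg' : (fun y => ‖g y‖ₑ) =ᵐ[μ] fun y => ‖g' y‖ₑ := hgg.fun_comp enorm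
  have hkk' : (fun y => ‖k y‖ₑ) =ᵐ[μ] fun y => ‖k' y‖ₑ := hkk.fun_comp enorm
  rw [mlconvolution_congr μ hff' hgg', mlconvolution_congr μ (ae_eq_refl _) hkk'] at h
  rw [groupConv_congr μ hff hgg, groupConv_congr μ hgg hkk, groupConv_congr μ hff (ae_eq_refl _),
    groupConv_congr μ (ae_eq_refl _) hkk]
  have hf := measurable_of_baire hf'
  have hg := measurable_of_baire hg'
  have hk := measurable_of_baire hk'
  have hm : Measurable (uncurry fun y z : G => f' z * g' (z⁻¹ * y) * k' (y⁻¹ * x)) :=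
    ((hf.comp measurable_snd).mul ((measurable_comp_inv_mul_of_baire hg').comp measurable_swap)).mul
      (hk.comp (measurable_fst.inv.mul_const x))
  have hint : Integrable (uncurry fun y z : G => f' z * g' (z⁻¹ * y) * k' (y⁻¹ * x))
      (μ.prod μ) := by
    refine ⟨hm.aestronglyMeasurable, ?_⟩
    rw [hasFiniteIntegral_iff_enorm, lintegral_prod _ hm.enorm.aemeasurable]
    convert h using 1
    refine lintegral_congr fun y => ?_
    have hm : Measurable fun z => ‖f' z‖ₑ * ‖g' (z⁻¹ * y)‖ₑ :=
      hf.enorm.mul (hg.comp (measurable_inv.mul_const y)).enorm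
    simp only [uncurry, enorm_mul]
    rw [lintegral_mul_const _ hm]
    rfl
  calc groupConv μ (groupConv μ f' g') k' x
      = ∫ y, ∫ z, f' z * g' (z⁻¹ * y) * k' (y⁻¹ * x) ∂μ ∂μ := by
        refine integral_congr_ae (Eventually.of_forall fun y => ?_)
        simp only [integral_mul_const]
        rfl
    _ = ∫ z, ∫ y, f' z * g' (z⁻¹ * y) * k' (y⁻¹ * x) ∂μ ∂μ := integral_integral_swap hint
    _ = groupConv μ f' (groupConv μ g' k') x := by
        refine integral_congr_ae (Eventually.of_forall fun z => ?_)
        simp only [mul_assoc, integral_const_mul, groupConv]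
        rw [← integral_mul_left_eq_self (fun w => g' w * k' (w⁻¹ * (z⁻¹ * x))) z⁻¹]
        simp [mul_assoc]

theorem groupConv_assoc {f g k : G → ℂ} (hf : MemLp f 1 μ) (hg : MemLp g 1 μ) {p : ℝ≥0∞}
    (hp : 1 ≤ p) (hp' : p ≠ ∞) (hk : MemLp k p μ) :
    groupConv μ (groupConv μ f g) k =ᵐ[μ] groupConv μ f (groupConv μ g k) := by
  have hm := measurable_mlconvolution μ hf.1.enorm hg.1.enorm
  have h1 := eLpNorm_mlconvolution_le μ hm.aemeasurable hk.1.enorm hp hp'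
  rw [lintegral_mlconvolution μ hf.1.enorm hg.1.enorm, ← eLpNorm_one_eq_lintegral_enorm,
    ← eLpNorm_one_eq_lintegral_enorm, eLpNorm_enorm_eq] at h1
  filter_upwards [ae_lt_top_of_eLpNorm_lt_top (measurable_mlconvolution μ hm.aemeasurable hk.1.enorm)
    hp hp' (h1.trans_lt (ENNReal.mul_lt_top (ENNReal.mul_lt_top hf.2 hg.2) hk.2))] with x hx
  exact groupConv_assoc_apply μ hf.1 hg.1 hk.1 hx

/-- The involution `f^*(x) = conj f(x⁻¹)`. -/
def convStar (f : G → ℂ) (x : G) : ℂ := starRingEnd ℂ (f x⁻¹)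

theorem memLp_convStar {f : G → ℂ} {p : ℝ≥0∞} (hf : MemLp f p μ) : MemLp (convStar f) p μ :=
  (hf.comp_measurePreserving (Measure.measurePreserving_inv μ)).star

theorem convStar_congr {f f' : G → ℂ} (h : f =ᵐ[μ] f') : convStar f =ᵐ[μ] convStar f' := by
  have := (Measure.measurePreserving_inv μ).quasiMeasurePreserving.ae_eq_comp h
  filter_upwards [this] with x hx
  simp only [comp_apply] at hx
  simp [convStar, hx]

/-- This identifies the adjoint of λ(f) as λ(f*). Fubini, the substitution x ↦ yx, Fubini again and
the substitution y ↦ y⁻¹ give it. -/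
theorem integral_conj_groupConv_mul {f g k : G → ℂ} (hf : MemLp f 1 μ) (hg : MemLp g 2 μ)
    (hk : MemLp k 2 μ) :
    ∫ x, starRingEnd ℂ (groupConv μ f g x) * k x ∂μ =
      ∫ x, starRingEnd ℂ (g x) * groupConv μ (convStar f) k x ∂μ := by
  obtain ⟨f', hf', hff⟩ := hf.1.aemeasurable.exists_baire_ae_eq_complex μ
  obtain ⟨g', hg', hgg⟩ := hg.1.aemeasurable.exists_baire_ae_eq_complex μ
  obtain ⟨k', hk', hkk⟩ := hk.1.aemeasurable.exists_baire_ae_eq_complex μ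
  replace hf := (memLp_congr_ae hff).1 hf
  replace hg := (memLp_congr_ae hgg).1 hg
  replace hk := (memLp_congr_ae hkk).1 hk
  rw [groupConv_congr μ hff hgg, groupConv_congr μ (convStar_congr μ hff) hkk]
  have e1 : ∫ x, starRingEnd ℂ (groupConv μ f' g' x) * k x ∂μ =
      ∫ x, starRingEnd ℂ (groupConv μ f' g' x) * k' x ∂μ := by
    refine integral_congr_ae ?_
    filter_upwards [hkk] with x hx
    rw [hx]
  have e2 : ∫ x, starRingEnd ℂ (g x) * groupConv μ (convStar f') k' x ∂μ =
      ∫ x, starRingEnd ℂ (g' x) * groupConv μ (convStar f') k' x ∂μ := by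
    refine integral_congr_ae ?_
    filter_upwards [hgg] with x hx
    rw [hx]
  rw [e1, e2]
  have hfm := measurable_of_baire hf'
  have hgm := measurable_of_baire hg'
  have hkm := measurable_of_baire hk'
  have hc : Measurable (starRingEnd ℂ) := Complex.continuous_conj.measurable
  have hm : Measurable (uncurry fun x y : G =>
      starRingEnd ℂ (f' y) * starRingEnd ℂ (g' (y⁻¹ * x)) * k' x) :=
    ((hc.comp (hfm.comp measurable_snd)).mul
      (hc.comp ((measurable_comp_inv_mul_of_baire hg').comp measurable_swap))).mul
      (hkm.comp measurable_fst)
  have hint : Integrable (uncurry fun x y : G =>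
      starRingEnd ℂ (f' y) * starRingEnd ℂ (g' (y⁻¹ * x)) * k' x) (μ.prod μ) := by
    refine ⟨hm.aestronglyMeasurable, ?_⟩
    rw [hasFiniteIntegral_iff_enorm, lintegral_prod _ hm.enorm.aemeasurable]
    have h1 : ∀ x, ∫⁻ y, ‖uncurry (fun x y : G =>
        starRingEnd ℂ (f' y) * starRingEnd ℂ (g' (y⁻¹ * x)) * k' x) (x, y)‖ₑ ∂μ =
        mlconvolution (fun y => ‖f' y‖ₑ) (fun y => ‖g' y‖ₑ) μ x * ‖k' x‖ₑ := by
      intro x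
      have hm : Measurable fun y => ‖f' y‖ₑ * ‖g' (y⁻¹ * x)‖ₑ :=
        hfm.enorm.mul (hgm.comp (measurable_inv.mul_const x)).enorm
      simp only [uncurry, enorm_mul, RCLike.enorm_conj]
      rw [lintegral_mul_const _ hm]
      rfl
    simp only [h1]
    have h2 := eLpNorm_mlconvolution_enorm_le μ hf.1 hg.1 one_le_two ENNReal.ofNat_ne_top
    have h3 := ENNReal.lintegral_mul_le_Lp_mul_Lq μ Real.HolderConjugate.two_two
      (measurable_mlconvolution μ hf.1.enorm hg.1.enorm).aemeasurable hk.1.enorm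
    refine h3.trans_lt (ENNReal.mul_lt_top ?_ ?_)
    · have h4 := h2.trans_lt (ENNReal.mul_lt_top hf.2 hg.2)
      rwa [eLpNorm_eq_lintegral_rpow_enorm_toReal two_ne_zero ENNReal.ofNat_ne_top] at h4
    · have h4 := hk.2
      rwa [eLpNorm_eq_lintegral_rpow_enorm_toReal two_ne_zero ENNReal.ofNat_ne_top] at h4
  have hm2 : Measurable (uncurry fun y x : G =>
      starRingEnd ℂ (g' x) * (starRingEnd ℂ (f' y) * k' (y * x))) := by
    refine (hc.comp (hgm.comp measurable_snd)).mul ((hc.comp (hfm.comp measurable_fst)).mul ?_)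
    exact hk'.comp (Continuous.measurable_prod_baireSpace (φ := fun z : G × G => z.1 * z.2)
      (by fun_prop))
  have hint2 : Integrable (uncurry fun y x : G =>
      starRingEnd ℂ (g' x) * (starRingEnd ℂ (f' y) * k' (y * x))) (μ.prod μ) := by
    refine ⟨hm2.aestronglyMeasurable, ?_⟩
    have h5 := hint.2
    rw [hasFiniteIntegral_iff_enorm, lintegral_prod_symm _ hm.enorm.aemeasurable] at h5
    rw [hasFiniteIntegral_iff_enorm, lintegral_prod _ hm2.enorm.aemeasurable]
    refine lt_of_eq_of_lt ?_ h5
    refine lintegral_congr fun y => ?_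
    refine Eq.trans ?_ (lintegral_mul_left_eq_self _ y)
    refine lintegral_congr fun x => ?_
    simp only [uncurry, inv_mul_cancel_left, enorm_mul]
    ring
  calc ∫ x, starRingEnd ℂ (groupConv μ f' g' x) * k' x ∂μ
      = ∫ x, ∫ y, starRingEnd ℂ (f' y) * starRingEnd ℂ (g' (y⁻¹ * x)) * k' x ∂μ ∂μ := by
        refine integral_congr_ae (Eventually.of_forall fun x => ?_)
        simp only [integral_mul_const, groupConv, ← integral_conj, map_mul]
    _ = ∫ y, ∫ x, starRingEnd ℂ (f' y) * starRingEnd ℂ (g' (y⁻¹ * x)) * k' x ∂μ ∂μ :=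
        integral_integral_swap hint
    _ = ∫ y, ∫ x, starRingEnd ℂ (g' x) * (starRingEnd ℂ (f' y) * k' (y * x)) ∂μ ∂μ := by
        refine integral_congr_ae (Eventually.of_forall fun y => ?_)
        simp only
        rw [← integral_mul_left_eq_self _ y]
        refine integral_congr_ae (Eventually.of_forall fun x => ?_)
        simp only [inv_mul_cancel_left]
        ring
    _ = ∫ x, ∫ y, starRingEnd ℂ (g' x) * (starRingEnd ℂ (f' y) * k' (y * x)) ∂μ ∂μ :=
        integral_integral_swap hint2
    _ = _ := by
        refine integral_congr_ae (Eventually.of_forall fun x => ?_)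
        simp only [integral_const_mul, groupConv, convStar]
        congr 1
        rw [← integral_inv_eq_self _ μ]

end ComplexConvolution

/-! ### A growth lemma for real sequences -/

section Growth

/-- A sequence with `L (k + 1) ≤ (2 - θ) L k + O(k)` grows more slowly than `2 ^ k`. -/
theorem tendsto_div_two_pow_of_le {L : ℕ → ℝ} {θ c : ℝ} (hL : ∀ k, 0 ≤ L k) (hθ : 0 < θ)
    (hθ' : θ ≤ 1) (h : ∀ k, L (k + 1) ≤ (2 - θ) * L k + c * (k + 1)) :
    Tendsto (fun k => L k / 2 ^ k) atTop (𝓝 0) := by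
  -- β lies strictly between 2 - θ and 2. The gap β - (2 - θ) = θ/2 absorbs the linear term, as k +
  -- 1 ≤ 2β^k and P is chosen with 2|c| ≤ Pθ/2; since β < 2, a bound P β^k suffices.
  set β : ℝ := 2 - θ / 2 with hβ
  have hβ1 : 3 / 2 ≤ β := by linarith
  have hpow : ∀ k : ℕ, (k : ℝ) + 1 ≤ 2 * β ^ k := by
    intro k
    have h1 : (1 : ℝ) + k * (1 / 2) ≤ (1 + 1 / 2) ^ k :=
      one_add_mul_le_pow (by norm_num) k
    have h2 : ((1 : ℝ) + 1 / 2) ^ k ≤ β ^ k := pow_le_pow_left₀ (by norm_num) (by linarith) k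
    linarith
  obtain ⟨P, hP0, hPL, hPc⟩ : ∃ P : ℝ, 0 ≤ P ∧ L 0 ≤ P ∧ 2 * |c| ≤ P * (θ / 2) := by
    refine ⟨L 0 + 4 * |c| / θ, by have := hL 0; positivity, ?_, ?_⟩
    · have : 0 ≤ 4 * |c| / θ := by positivity
      linarith
    · have h1 : (L 0 + 4 * |c| / θ) * (θ / 2) = L 0 * (θ / 2) + 2 * |c| := by
        field_simp
        ring
      have := mul_nonneg (hL 0) (half_pos hθ).le
      linarith
  have hbound : ∀ k, L k ≤ P * β ^ k := by
    intro k
    induction k with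
    | zero => simpa using hPL
    | succ k ih =>
      have hb : 0 ≤ β ^ k := by positivity
      calc L (k + 1) ≤ (2 - θ) * L k + c * (k + 1) := h k
        _ ≤ (2 - θ) * (P * β ^ k) + |c| * (2 * β ^ k) := by
          refine add_le_add (mul_le_mul_of_nonneg_left ih (by linarith)) ?_
          exact mul_le_mul (le_abs_self c) (hpow k) (by positivity) (abs_nonneg c)
        _ ≤ (2 - θ) * (P * β ^ k) + P * (θ / 2) * β ^ k := by nlinarith
        _ = P * β ^ (k + 1) := by rw [pow_succ, hβ]; ring
  have h0 : Tendsto (fun k : ℕ => P * (β / 2) ^ k) atTop (𝓝 0) := by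
    have := tendsto_pow_atTop_nhds_zero_of_lt_one (r := β / 2) (by positivity) (by linarith)
    simpa using this.const_mul P
  refine squeeze_zero (fun k => by have := hL k; positivity) (fun k => ?_) h0
  rw [div_pow, ← mul_div_assoc]
  exact div_le_div_of_nonneg_right (hbound k) (by positivity)

end Growth

/-! ### σ-compactness and inversion invariance of Haar measure -/

section SigmaCompact

open scoped Pointwise

variable {G : Type*} [Group G] [TopologicalSpace G] [IsTopologicalGroup G]
  [LocallyCompactSpace G] [T2Space G] [MeasurableSpace G] [BorelSpace G]

/-- A locally compact group with a σ-finite Haar measure is σ-compact. -/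
theorem sigmaCompactSpace_of_sigmaFinite_haar (μ : Measure G) [μ.IsHaarMeasure] [SigmaFinite μ] :
    SigmaCompactSpace G := by
  obtain ⟨V, hV, hV1⟩ := exists_compact_mem_nhds (1 : G)
  -- A maximal family of disjoint translates of an open set of positive measure is countable by
  -- σ-finiteness, and by maximality the translates of the compact set V V⁻¹ by the same elements
  -- cover G.
  obtain ⟨T, hT⟩ := zorn_subset {T : Set G | T.PairwiseDisjoint fun t => t • interior V} (by
    intro c hc hchain
    refine ⟨⋃₀ c, ?_, fun s hs => Set.subset_sUnion_of_mem hs⟩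
    exact (Set.pairwiseDisjoint_sUnion hchain.directedOn).2 fun s hs => hc hs)
  have h1 : (1 : G) ∈ interior V := mem_interior_iff_mem_nhds.2 hV1
  have hTc : T.Countable := by
    have hd : Pairwise (Disjoint on fun t : T => (t : G) • interior V) := fun a b hab =>
      hT.prop a.2 b.2 fun h => hab (Subtype.ext h)
    have := Measure.countable_meas_pos_of_disjoint_iUnion (μ := μ)
      (As := fun t : T => (t : G) • interior V)
      (fun t => (isOpen_interior.smul _).measurableSet) hd
    have huniv : {t : T | 0 < μ ((t : G) • interior V)} = Set.univ := by
      ext t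
      simp only [Set.mem_ofPred_eq, Set.mem_univ, iff_true, measure_smul]
      exact isOpen_interior.measure_pos μ ⟨1, h1⟩
    rw [huniv] at this
    exact Set.countable_coe_iff.1 (Set.countable_univ_iff.1 this)
  have hcov : ⋃ t ∈ T, t • (V * V⁻¹) = Set.univ := by
    refine Set.eq_univ_of_forall fun x => ?_
    by_contra hx
    have hx' : ∀ t ∈ T, Disjoint (t • interior V) (x • interior V) := by
      intro t ht
      rw [Set.disjoint_left]
      rintro _ ⟨a, ha, rfl⟩ ⟨b, hb, hab⟩
      refine hx (Set.mem_iUnion₂.2 ⟨t, ht, a * b⁻¹, ?_, ?_⟩)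
      · exact Set.mul_mem_mul (interior_subset ha) (Set.inv_mem_inv.2 (interior_subset hb))
      · simp only [smul_eq_mul] at hab ⊢
        rw [← mul_assoc, ← hab, mul_inv_cancel_right]
    have hins : insert x T ∈ {T : Set G | T.PairwiseDisjoint fun t => t • interior V} :=
      Set.PairwiseDisjoint.insert hT.prop fun t ht _ => (hx' t ht).symm
    have hxT : x ∈ T := hT.le_of_ge hins (Set.subset_insert x T) (Set.mem_insert x T)
    refine hx (Set.mem_iUnion₂.2 ⟨x, hxT, 1, ?_, by simp⟩)
    exact ⟨1, interior_subset h1, 1, by simpa using interior_subset h1, by simp⟩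
  refine isSigmaCompact_univ_iff.1 (hcov ▸ ?_)
  exact isSigmaCompact_biUnion hTc fun t _ => ((hV.mul hV.inv).smul t).isSigmaCompact

/-- A regular Haar measure on a unimodular group is invariant under inversion. -/
theorem isInvInvariant_of_isMulRightInvariant (μ : Measure G) [μ.IsHaarMeasure] [μ.Regular]
    [μ.IsMulRightInvariant] : μ.IsInvInvariant := by
  constructor
  let c : ℝ≥0∞ := Measure.haarScalarFactor μ.inv μ
  -- Right invariance of μ makes its inverse left invariant, hence a multiple c of μ; inverting
  -- twice gives c² = 1.
  have hc : μ.inv = c • μ := Measure.isMulLeftInvariant_eq_smul_of_regular μ.inv μ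
  have : Measure.map Inv.inv (Measure.map Inv.inv μ) = c ^ 2 • μ := by
    rw [← Measure.inv_def μ, hc, Measure.map_smul, ← Measure.inv_def μ, hc, smul_smul, pow_two]
  have μeq : μ = c ^ 2 • μ := by
    rw [Measure.map_map continuous_inv.measurable continuous_inv.measurable] at this
    simpa only [inv_involutive, Involutive.comp_self, Measure.map_id]
  have K : TopologicalSpace.PositiveCompacts G := Classical.arbitrary _
  have : c ^ 2 * μ K = 1 ^ 2 * μ K := by
    conv_rhs => rw [μeq]
    simp
  have : c ^ 2 = 1 ^ 2 :=
    (ENNReal.mul_left_inj (Measure.measure_pos_of_nonempty_interior _ K.interior_nonempty).ne'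
          K.isCompact.measure_lt_top.ne).1 this
  have : c = 1 := (ENNReal.pow_right_strictMono two_ne_zero).injective this
  rw [hc, this, one_smul]

end SigmaCompact

/-! ### Controlled weights: Chebyshev estimates -/

/-- A weight `ω` whose defect of multiplicativity `ω (x y) / (ω x ω y)` is at most `u x + u y`, for
a bounded function `u` such that `ω u` is bounded away from zero and `u ^ s * ω ^ r` is integrable,
with `s ≥ 1` and `r > 0`. -/
structure IsControlledWeight {G : Type*} [Group G] [MeasurableSpace G] (μ : Measure G)
    (ω u : G → ℝ) (s r c M : ℝ) : Prop where
  isWeight : IsWeight ω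
  measurable_bound : Measurable u
  c_pos : 0 < c
  le_mul : ∀ x, c ≤ ω x * u x
  bound_le : ∀ x, u x ≤ M
  one_le_s : 1 ≤ s
  r_pos : 0 < r
  map_mul_le : ∀ x y, ω (x * y) ≤ ω x * ω y * (u x + u y)
  integrable : Integrable (fun x => u x ^ s * ω x ^ r) μ

namespace IsControlledWeight

section Basic

variable {G : Type*} [Group G] [MeasurableSpace G] {μ : Measure G} {ω u : G → ℝ} {s r c M : ℝ}
  (h : IsControlledWeight μ ω u s r c M)

include h

theorem weight_pos (x : G) : 0 < ω x := one_pos.trans_le (h.isWeight.one_le x)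

theorem bound_pos (x : G) : 0 < u x := by
  have h1 := h.c_pos.trans_le (h.le_mul x)
  exact (mul_pos_iff_of_pos_left (h.weight_pos x)).1 h1

theorem M_pos : 0 < M := (h.bound_pos 1).trans_le (h.bound_le 1)

theorem s_pos : 0 < s := one_pos.trans_le h.one_le_s

theorem density_pos (x : G) : 0 < u x ^ s * ω x ^ r :=
  mul_pos (Real.rpow_pos_of_pos (h.bound_pos x) s) (Real.rpow_pos_of_pos (h.weight_pos x) r)

/-- Chebyshev's inequality for the density `u ^ s * ω ^ r`. -/
theorem measure_le_of_density_ge {ε : ℝ} (hε : 0 < ε) {E : Set G}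
    (hE : ∀ x ∈ E, ε ≤ u x ^ s * ω x ^ r) :
    μ E ≤ ENNReal.ofReal ((∫ x, u x ^ s * ω x ^ r ∂μ) / ε) := by
  have h0 : 0 ≤ᵐ[μ] fun x => u x ^ s * ω x ^ r := ae_of_all _ fun x => (h.density_pos x).le
  have h1 := mul_meas_ge_le_integral_of_nonneg h0 h.integrable ε
  have h2 := h.integrable.measure_ge_lt_top hε
  refine (measure_mono (t := {x | ε ≤ u x ^ s * ω x ^ r}) hE).trans ?_
  rw [← ENNReal.ofReal_toReal h2.ne]
  refine ENNReal.ofReal_le_ofReal ?_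
  rw [le_div_iff₀ hε, mul_comm]
  exact h1

theorem exists_mem_density_lt {K : ℝ} (hK : 0 < K) {E : Set G}
    (hE : ENNReal.ofReal ((∫ x, u x ^ s * ω x ^ r ∂μ) / K) < μ E) :
    ∃ z ∈ E, u z ^ s * ω z ^ r < K := by
  by_contra! hcon
  exact (h.measure_le_of_density_ge hK hcon).not_gt hE

/-- Sublevel sets of a controlled weight have polynomially bounded measure. -/
theorem exists_measure_sublevel_le :
    ∃ C, 0 < C ∧ ∀ R, 1 ≤ R → μ {x | ω x ≤ R} ≤ ENNReal.ofReal (C * R ^ s) := by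
  have hI : 0 ≤ ∫ x, u x ^ s * ω x ^ r ∂μ := integral_nonneg fun x => (h.density_pos x).le
  have hc := Real.rpow_pos_of_pos h.c_pos s
  refine ⟨(∫ x, u x ^ s * ω x ^ r ∂μ) / c ^ s + 1, by positivity, fun R hR => ?_⟩
  have hR0 : 0 < R := by linarith
  have hRs := Real.rpow_pos_of_pos hR0 s
  -- On {ω ≤ R} one has u ≥ c/ω ≥ c/R and ω^r ≥ 1, so the density is at least (c/R)^s there.
  refine (h.measure_le_of_density_ge (ε := (c / R) ^ s) (by have := h.c_pos; positivity)
    fun x hx => ?_).trans (ENNReal.ofReal_le_ofReal ?_)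
  · have h1 : c / R ≤ u x := by
      rw [div_le_iff₀ hR0]
      calc c ≤ ω x * u x := h.le_mul x
        _ ≤ R * u x := mul_le_mul_of_nonneg_right hx (h.bound_pos x).le
        _ = u x * R := mul_comm _ _
    have h2 : (c / R) ^ s ≤ u x ^ s :=
      Real.rpow_le_rpow (by have := h.c_pos; positivity) h1 h.s_pos.le
    have h3 : 1 ≤ ω x ^ r := Real.one_le_rpow (h.isWeight.one_le x) h.r_pos.le
    exact h2.trans (le_mul_of_one_le_right (Real.rpow_pos_of_pos (h.bound_pos x) s).le h3)
  · rw [Real.div_rpow h.c_pos.le hR0.le, div_div_eq_mul_div, add_mul, one_mul, div_mul_eq_mul_div]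
    linarith

theorem measurableSet_sublevel (R : ℝ) : MeasurableSet {x | ω x ≤ R} :=
  measurableSet_le h.isWeight.measurable measurable_const

theorem measure_sublevel_lt_top (R : ℝ) : μ {x | ω x ≤ R} < ∞ := by
  obtain ⟨C, -, hC⟩ := h.exists_measure_sublevel_le
  exact (measure_mono fun x (hx : ω x ≤ R) => hx.trans (le_max_left R 1)).trans_lt
    ((hC (max R 1) (le_max_right _ _)).trans_lt ENNReal.ofReal_lt_top)

theorem sigmaFinite : SigmaFinite μ := by
  refine ⟨⟨⟨fun n : ℕ => {x | ω x ≤ n}, fun _ => trivial, fun n => h.measure_sublevel_lt_top n, ?_⟩⟩⟩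
  refine Set.eq_univ_of_forall fun x => Set.mem_iUnion.2 ?_
  exact exists_nat_ge (ω x)

/-- Points close to `x` with small density have small bound. -/
theorem bound_le_of_density_lt {K W : ℝ} (hW : 1 ≤ W) {x z : G}
    (hz : u z ^ s * ω z ^ r < K) (hxz : ω x ≤ W * ω z) :
    u z ≤ K ^ s⁻¹ * W ^ (r / s) * ω x ^ (-(r / s)) := by
  have hu := h.bound_pos z
  have hK : 0 < K := (h.density_pos z).trans hz
  have hs := h.s_pos
  have hx := h.weight_pos x
  have hωz := h.weight_pos z
  have hW0 : 0 < W := by linarith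
  have h1 : u z ^ s * (ω x / W) ^ r ≤ K := by
    refine le_trans (mul_le_mul_of_nonneg_left ?_ (Real.rpow_nonneg hu.le s)) hz.le
    refine Real.rpow_le_rpow (by positivity) ?_ h.r_pos.le
    rw [div_le_iff₀ hW0, mul_comm]
    exact hxz
  have h2 : u z ^ s ≤ K * (ω x / W) ^ (-r) := by
    rw [Real.rpow_neg (by positivity), ← div_eq_mul_inv, le_div_iff₀ (by positivity)]
    exact h1
  calc u z = (u z ^ s) ^ s⁻¹ := by rw [Real.rpow_rpow_inv hu.le hs.ne']
    _ ≤ (K * (ω x / W) ^ (-r)) ^ s⁻¹ := Real.rpow_le_rpow (by positivity) h2 (by positivity)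
    _ = _ := by
      rw [Real.mul_rpow hK.le (by positivity), ← Real.rpow_mul (by positivity),
        Real.div_rpow hx.le hW0.le, neg_mul, ← div_eq_mul_inv, Real.rpow_neg hW0.le,
        div_inv_eq_mul]
      ring

end Basic

/-! ### A controlled weight forces unimodularity -/

section Haar

variable {G : Type*} [Group G] [TopologicalSpace G] [IsTopologicalGroup G]
  [LocallyCompactSpace G] [T2Space G] [MeasurableSpace G] [BorelSpace G]
  {μ : Measure G} [μ.IsHaarMeasure] [μ.Regular] {ω u : G → ℝ} {s r c M : ℝ}
  (h : IsControlledWeight μ ω u s r c M)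

include h

theorem sigmaCompactSpace : SigmaCompactSpace G :=
  have := h.sigmaFinite
  sigmaCompactSpace_of_sigmaFinite_haar μ

/-- ω is only measurable, so this replaces local boundedness. By Steinhaus, E/E is a neighbourhood
of 1 for a sublevel set E of positive measure, and ω ≤ n² on it. -/
theorem exists_sublevel_mem_nhds : ∃ W, 1 ≤ W ∧ {x | ω x ≤ W} ∈ 𝓝 (1 : G) := by
  have := h.sigmaFinite
  obtain ⟨n, hn⟩ : ∃ n : ℕ, 0 < μ {x | ω x ≤ n} := by
    by_contra! hcon
    have h1 : μ (⋃ n : ℕ, {x | ω x ≤ n}) = 0 :=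
      measure_iUnion_null fun n => le_antisymm (hcon n) bot_le
    have h2 : ⋃ n : ℕ, {x | ω x ≤ n} = Set.univ :=
      Set.eq_univ_of_forall fun x => Set.mem_iUnion.2 (exists_nat_ge (ω x))
    rw [h2] at h1
    exact (isOpen_univ.measure_pos μ Set.univ_nonempty).ne' h1
  refine ⟨max 1 ((n : ℝ) * n), le_max_left _ _, ?_⟩
  filter_upwards [Measure.div_mem_nhds_one_of_haar_pos μ _ (h.measurableSet_sublevel n) hn]
  rintro _ ⟨a, ha, b, hb, rfl⟩
  refine le_trans ?_ (le_max_right _ _)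
  simp only [div_eq_mul_inv]
  refine (h.isWeight.map_mul_le _ _).trans ?_
  rw [h.isWeight.map_inv]
  exact mul_le_mul ha hb (h.isWeight.nonneg b) (Nat.cast_nonneg n)

theorem measure_preimage_mul_right (g : G) {E : Set G} (hE : MeasurableSet E) :
    μ ((· * g) ⁻¹' E) = Measure.modularCharacterFun g * μ E := by
  have := h.sigmaFinite
  rw [← Measure.map_apply (measurable_mul_const g) hE,
    Measure.map_right_mul_eq_modularCharacterFun_smul]
  rfl

/-- Right translation by g⁻¹ scales the measure of {ω ≤ W} by Δ(g) and maps this set into {ω ≤ W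
ω(g)}, whose measure is polynomially bounded. -/
theorem exists_modularCharacterFun_le :
    ∃ C : ℝ, 1 ≤ C ∧ ∀ g : G, (Measure.modularCharacterFun g : ℝ) ≤ C * ω g ^ s := by
  obtain ⟨C, hC0, hC⟩ := h.exists_measure_sublevel_le
  obtain ⟨W, hW1, hW⟩ := h.exists_sublevel_mem_nhds
  have hpos : 0 < μ {x | ω x ≤ W} := Measure.measure_pos_of_mem_nhds μ hW
  have hfin := h.measure_sublevel_lt_top W
  have hm : 0 < (μ {x | ω x ≤ W}).toReal := ENNReal.toReal_pos hpos.ne' hfin.ne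
  refine ⟨max 1 (C * W ^ s / (μ {x | ω x ≤ W}).toReal), le_max_left _ _, fun g => ?_⟩
  have hg := h.weight_pos g
  have hW0 : 0 < W := by linarith
  have h1 : μ ((· * g) ⁻¹' {x | ω x ≤ W}) ≤ ENNReal.ofReal (C * (W * ω g) ^ s) := by
    refine (measure_mono fun x (hx : ω (x * g) ≤ W) => ?_).trans (hC (W * ω g)
      (one_le_mul_of_one_le_of_one_le hW1 (h.isWeight.one_le g)))
    calc ω x = ω (x * g * g⁻¹) := by rw [mul_inv_cancel_right]
      _ ≤ ω (x * g) * ω g⁻¹ := h.isWeight.map_mul_le _ _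
      _ ≤ W * ω g := by
        rw [h.isWeight.map_inv]
        exact mul_le_mul_of_nonneg_right hx hg.le
  rw [h.measure_preimage_mul_right g (h.measurableSet_sublevel W)] at h1
  have h2 := ENNReal.toReal_mono ENNReal.ofReal_ne_top h1
  rw [ENNReal.toReal_mul, ENNReal.coe_toReal, ENNReal.toReal_ofReal (by positivity),
    Real.mul_rpow hW0.le hg.le, ← mul_assoc] at h2
  calc (Measure.modularCharacterFun g : ℝ) ≤ C * W ^ s * ω g ^ s / (μ {x | ω x ≤ W}).toReal := by
        rwa [le_div_iff₀ hm]
    _ = C * W ^ s / (μ {x | ω x ≤ W}).toReal * ω g ^ s := by ring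
    _ ≤ _ := mul_le_mul_of_nonneg_right (le_max_right _ _) (by positivity)

/-- The element z is an approximate square of x: z = ab with a = xv, b = wx and v, w in a fixed
sublevel set, chosen so that the density is small at a and b. Then u(a) and u(b) are O(ω(x)^(-r/s)),
which improves ω(x)² to ω(x)^(2 - r/s), while Δ(z) is Δ(x)² up to a constant. -/
theorem exists_modular_step :
    ∃ B D : ℝ, 1 ≤ B ∧ 1 ≤ D ∧ ∀ x : G, Measure.modularCharacterFun x ≤ 1 →
      ∃ z : G, ω z ≤ B * (ω x * ω x * ω x ^ (-(r / s))) ∧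
        (Measure.modularCharacterFun z : ℝ) ≤ D * (Measure.modularCharacterFun x : ℝ) ^ 2 := by
  obtain ⟨C, hC1, hC⟩ := h.exists_modularCharacterFun_le
  obtain ⟨W, hW1, hW⟩ := h.exists_sublevel_mem_nhds
  have hpos : 0 < μ {x | ω x ≤ W} := Measure.measure_pos_of_mem_nhds μ hW
  have hfin := h.measure_sublevel_lt_top W
  have hm : 0 < (μ {x | ω x ≤ W}).toReal := ENNReal.toReal_pos hpos.ne' hfin.ne
  have hW0 : 0 < W := by linarith
  set m := (μ {x | ω x ≤ W}).toReal with hm_def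
  set I := ∫ x, u x ^ s * ω x ^ r ∂μ with hI_def
  have hI : 0 ≤ I := integral_nonneg fun x => (h.density_pos x).le
  -- With this K, Chebyshev bounds the measure of {density ≥ K} by I/K < m, so every set of measure
  -- at least m contains a point of density below K.
  set K := (I + 1) / m with hK_def
  have hK : 0 < K := by positivity
  have hIK : ENNReal.ofReal (I / K) < μ {x | ω x ≤ W} := by
    rw [ENNReal.ofReal_lt_iff_lt_toReal (by positivity) hfin.ne, hK_def, div_div_eq_mul_div,
      div_lt_iff₀ (by positivity)]
    nlinarith
  have hCW : 1 ≤ C * W ^ s :=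
    one_le_mul_of_one_le_of_one_le hC1 (Real.one_le_rpow hW1 h.s_pos.le)
  set A := K ^ s⁻¹ * W ^ (r / s) with hA_def
  have hA : 0 < A := by positivity
  refine ⟨max 1 (W ^ 2 * (2 * A)), (C * W ^ s) ^ 2, le_max_left _ _, one_le_pow₀ hCW,
    fun x hx => ?_⟩
  have hx0 := h.weight_pos x
  obtain ⟨a, ha, hau⟩ := h.exists_mem_density_lt (E := (x⁻¹ * ·) ⁻¹' {x | ω x ≤ W}) hK (by
    rwa [measure_preimage_mul])
  -- Here Δ(x) ≤ 1 is needed: the right translate has measure Δ(x⁻¹) m, which must be at least m.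
  obtain ⟨b, hb, hbu⟩ := h.exists_mem_density_lt (E := (· * x⁻¹) ⁻¹' {x | ω x ≤ W}) hK (by
    rw [h.measure_preimage_mul_right _ (h.measurableSet_sublevel W)]
    refine hIK.trans_le (le_mul_of_one_le_left bot_le ?_)
    have h1 : Measure.modularCharacterFun x⁻¹ * Measure.modularCharacterFun x = 1 := by
      rw [← Measure.modularCharacterFun_map_mul, inv_mul_cancel,
        Measure.modularCharacterFun_map_one]
    have h2 : 1 ≤ Measure.modularCharacterFun x⁻¹ := by
      calc 1 = Measure.modularCharacterFun x⁻¹ * Measure.modularCharacterFun x := h1.symm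
        _ ≤ Measure.modularCharacterFun x⁻¹ * 1 := mul_le_mul_right hx _
        _ = _ := mul_one _
    exact_mod_cast h2)
  simp only [Set.mem_preimage, Set.mem_ofPred_eq] at ha hb
  have hxa : ω x ≤ W * ω a := by
    calc ω x = ω (a * (x⁻¹ * a)⁻¹) := by group
      _ ≤ ω a * ω (x⁻¹ * a)⁻¹ := h.isWeight.map_mul_le _ _
      _ ≤ ω a * W := by
        rw [h.isWeight.map_inv]
        exact mul_le_mul_of_nonneg_left ha (h.weight_pos a).le
      _ = W * ω a := mul_comm _ _
  have hxb : ω x ≤ W * ω b := by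
    calc ω x = ω ((b * x⁻¹)⁻¹ * b) := by group
      _ ≤ ω (b * x⁻¹)⁻¹ * ω b := h.isWeight.map_mul_le _ _
      _ ≤ W * ω b := by
        rw [h.isWeight.map_inv]
        exact mul_le_mul_of_nonneg_right hb (h.weight_pos b).le
  have hax : ω a ≤ ω x * W := by
    calc ω a = ω (x * (x⁻¹ * a)) := by group
      _ ≤ ω x * ω (x⁻¹ * a) := h.isWeight.map_mul_le _ _
      _ ≤ ω x * W := mul_le_mul_of_nonneg_left ha hx0.le
  have hbx : ω b ≤ W * ω x := by
    calc ω b = ω ((b * x⁻¹) * x) := by group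
      _ ≤ ω (b * x⁻¹) * ω x := h.isWeight.map_mul_le _ _
      _ ≤ W * ω x := mul_le_mul_of_nonneg_right hb hx0.le
  have hua := h.bound_le_of_density_lt hW1 hau hxa
  have hub := h.bound_le_of_density_lt hW1 hbu hxb
  refine ⟨a * b, ?_, ?_⟩
  · calc ω (a * b) ≤ ω a * ω b * (u a + u b) := h.map_mul_le a b
      _ ≤ (ω x * W) * (W * ω x) * (A * ω x ^ (-(r / s)) + A * ω x ^ (-(r / s))) := by
        refine mul_le_mul ?_ (add_le_add hua hub) ?_ (by positivity)
        · exact mul_le_mul hax hbx (h.weight_pos b).le (by positivity)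
        · exact (add_pos (h.bound_pos a) (h.bound_pos b)).le
      _ = W ^ 2 * (2 * A) * (ω x * ω x * ω x ^ (-(r / s))) := by ring
      _ ≤ _ := mul_le_mul_of_nonneg_right (le_max_right _ _) (by positivity)
  · have e : a * b = x * (x⁻¹ * a) * ((b * x⁻¹) * x) := by group
    have h1 : (Measure.modularCharacterFun (x⁻¹ * a) : ℝ) ≤ C * W ^ s :=
      (hC _).trans (mul_le_mul_of_nonneg_left
        (Real.rpow_le_rpow (h.weight_pos _).le ha h.s_pos.le) (by linarith))
    have h2 : (Measure.modularCharacterFun (b * x⁻¹) : ℝ) ≤ C * W ^ s :=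
      (hC _).trans (mul_le_mul_of_nonneg_left
        (Real.rpow_le_rpow (h.weight_pos _).le hb h.s_pos.le) (by linarith))
    have h3 := mul_le_mul h1 h2 (NNReal.coe_nonneg _) (by linarith)
    rw [e, Measure.modularCharacterFun_map_mul, Measure.modularCharacterFun_map_mul x,
      Measure.modularCharacterFun_map_mul (b * x⁻¹) x]
    push_cast
    nlinarith [mul_le_mul_of_nonneg_right h3
      (sq_nonneg (Measure.modularCharacterFun x : ℝ))]

/-- If Δ(g) < 1, iterating the approximate squaring from a high power of g makes Δ(x_k⁻¹) at least
2^(2^k), whereas Δ ≤ C ω^s and log ω(x_k) = o(2^k). -/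
theorem modularCharacterFun_ge_one (g : G) : 1 ≤ Measure.modularCharacterFun g := by
  by_contra! hg
  obtain ⟨B, D, hB, hD, hstep⟩ := h.exists_modular_step
  obtain ⟨C, hC1, hC⟩ := h.exists_modularCharacterFun_le
  have hD0 : 0 < D := by linarith
  have hsmall : ∃ x : G, D * (Measure.modularCharacterFun x : ℝ) ≤ 1 / 2 := by
    obtain ⟨n, hn⟩ := exists_pow_lt_of_lt_one (y := (Measure.modularCharacterFun g : ℝ))
      (x := 1 / (2 * D)) (by positivity) (by exact_mod_cast hg)
    refine ⟨g ^ n, ?_⟩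
    have : Measure.modularCharacterFun (g ^ n) = Measure.modularCharacterFun g ^ n :=
      map_pow Measure.modularCharacter g n
    rw [this]
    push_cast
    calc D * (Measure.modularCharacterFun g : ℝ) ^ n ≤ D * (1 / (2 * D)) :=
          mul_le_mul_of_nonneg_left hn.le hD0.le
      _ = 1 / 2 := by field_simp
  -- The condition D Δ(x) ≤ 1/2 implies Δ(x) ≤ 1 and is preserved, since the step gives D Δ(z) ≤ (D
  -- Δ(x))². So the step can be iterated indefinitely.
  let X := {x : G // D * (Measure.modularCharacterFun x : ℝ) ≤ 1 / 2}
  have hX : ∀ x : X, Measure.modularCharacterFun (x : G) ≤ 1 := fun x => by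
    have h1 := x.2
    have h2 : (Measure.modularCharacterFun (x : G) : ℝ) ≤ 1 := by
      nlinarith [NNReal.coe_nonneg (Measure.modularCharacterFun (x : G))]
    exact_mod_cast h2
  have hnext : ∀ x : X, ∃ z : X, ω z ≤ B * (ω x * ω x * ω x ^ (-(r / s))) ∧
      D * (Measure.modularCharacterFun (z : G) : ℝ) ≤
        (D * (Measure.modularCharacterFun (x : G) : ℝ)) ^ 2 := by
    intro x
    obtain ⟨z, hz1, hz2⟩ := hstep x (hX x)
    have h3 : D * (Measure.modularCharacterFun z : ℝ) ≤
        (D * (Measure.modularCharacterFun (x : G) : ℝ)) ^ 2 := by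
      calc D * (Measure.modularCharacterFun z : ℝ)
          ≤ D * (D * (Measure.modularCharacterFun (x : G) : ℝ) ^ 2) :=
            mul_le_mul_of_nonneg_left hz2 hD0.le
        _ = _ := by ring
    have h4 : 0 ≤ D * (Measure.modularCharacterFun (x : G) : ℝ) := by positivity
    exact ⟨⟨z, h3.trans (by nlinarith [x.2])⟩, hz1, h3⟩
  choose next hnext1 hnext2 using hnext
  obtain ⟨x₀, hx₀⟩ := hsmall
  let x : ℕ → X := fun k => next^[k] ⟨x₀, hx₀⟩
  have hxs : ∀ k, x (k + 1) = next (x k) := fun k => iterate_succ_apply' _ _ _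
  have hΔ : ∀ k, D * (Measure.modularCharacterFun (x k : G) : ℝ) ≤ (1 / 2) ^ 2 ^ k := by
    intro k
    induction k with
    | zero => simpa using (x 0).2
    | succ k ih =>
      rw [hxs, pow_succ 2 k, pow_mul]
      exact (hnext2 _).trans (pow_le_pow_left₀ (by positivity) ih 2)
  -- The exponent is truncated at 1 to meet the growth lemma; the bound on log ω only weakens, as
  -- log ω ≥ 0.
  set θ := min (r / s) 1 with hθ_def
  have hrs : 0 < r / s := div_pos h.r_pos h.s_pos
  have hθ : 0 < θ := lt_min hrs one_pos
  have hL0 : ∀ k, 0 ≤ Real.log (ω (x k)) := fun k => Real.log_nonneg (h.isWeight.one_le _)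
  have hlogB : 0 ≤ Real.log B := Real.log_nonneg hB
  have hL : ∀ k : ℕ, Real.log (ω (x (k + 1))) ≤
      (2 - θ) * Real.log (ω (x k)) + Real.log B * (k + 1) := by
    intro k
    have hωk := h.weight_pos (x k)
    have h1 := Real.log_le_log (h.weight_pos _) (hnext1 (x k))
    rw [← hxs, Real.log_mul (by positivity) (by positivity), Real.log_mul (by positivity)
      (by positivity), Real.log_mul (by positivity) (by positivity), Real.log_rpow hωk] at h1
    have h2 : θ ≤ r / s := min_le_left _ _
    have h3 := mul_le_mul_of_nonneg_right h2 (hL0 k)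
    have h4 : Real.log B ≤ Real.log B * (k + 1) :=
      le_mul_of_one_le_right hlogB (by have := Nat.cast_nonneg (α := ℝ) k; linarith)
    nlinarith
  have htend := tendsto_div_two_pow_of_le (L := fun k => Real.log (ω (x k))) hL0 hθ
    (min_le_right _ _) hL
  have hlower : ∀ k : ℕ, Real.log 2 ≤ Real.log C / 2 ^ k + s * (Real.log (ω (x k)) / 2 ^ k) := by
    intro k
    have hωk := h.weight_pos (x k)
    have h1 := hC (x k : G)⁻¹
    rw [h.isWeight.map_inv] at h1
    have h2 : (Measure.modularCharacterFun (x k : G)⁻¹ : ℝ) *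
        Measure.modularCharacterFun (x k : G) = 1 := by
      rw [← NNReal.coe_mul, ← Measure.modularCharacterFun_map_mul, inv_mul_cancel,
        Measure.modularCharacterFun_map_one, NNReal.coe_one]
    have h3 : (Measure.modularCharacterFun (x k : G) : ℝ) ≤ ((2 : ℝ) ^ 2 ^ k)⁻¹ :=
      ((le_mul_of_one_le_left (NNReal.coe_nonneg _) hD).trans (hΔ k)).trans_eq
        (by rw [one_div, inv_pow])
    have h4 : (2 : ℝ) ^ 2 ^ k ≤ C * ω (x k) ^ s := by
      refine le_trans ?_ h1
      have h5 : 0 < (Measure.modularCharacterFun (x k : G)⁻¹ : ℝ) := by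
        exact_mod_cast Measure.modularCharacterFun_pos _
      have h6 : (1 : ℝ) ≤ (Measure.modularCharacterFun (x k : G)⁻¹ : ℝ) * (2 ^ 2 ^ k)⁻¹ := by
        exact h2.symm.le.trans (mul_le_mul_of_nonneg_left h3 h5.le)
      rwa [← div_eq_mul_inv, le_div_iff₀ (by positivity), one_mul] at h6
    have h5 := Real.log_le_log (by positivity) h4
    rw [Real.log_pow, Real.log_mul (by positivity) (by positivity), Real.log_rpow hωk] at h5
    push_cast at h5
    rw [mul_div_assoc', ← add_div, le_div_iff₀ (by positivity), mul_comm]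
    exact h5
  have hlim : Tendsto (fun k : ℕ => Real.log C / 2 ^ k + s * (Real.log (ω (x k)) / 2 ^ k)) atTop
      (𝓝 (0 + s * 0)) := by
    refine Tendsto.add ?_ (htend.const_mul s)
    exact tendsto_const_nhds.div_atTop (tendsto_pow_atTop_atTop_of_one_lt one_lt_two)
  have := ge_of_tendsto' hlim hlower
  have h2 : 0 < Real.log 2 := Real.log_pos one_lt_two
  linarith

theorem modularCharacterFun_eq_one (g : G) : Measure.modularCharacterFun g = 1 := by
  refine le_antisymm ?_ (h.modularCharacterFun_ge_one g)
  have h1 := h.modularCharacterFun_ge_one g⁻¹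
  have h2 : Measure.modularCharacterFun g⁻¹ * Measure.modularCharacterFun g = 1 := by
    rw [← Measure.modularCharacterFun_map_mul, inv_mul_cancel, Measure.modularCharacterFun_map_one]
  calc Measure.modularCharacterFun g ≤ Measure.modularCharacterFun g⁻¹ *
        Measure.modularCharacterFun g := le_mul_of_one_le_left bot_le h1
    _ = 1 := h2

/-- A group with a controlled weight is unimodular. -/
theorem isInvInvariant : μ.IsInvInvariant := by
  have := h.sigmaFinite
  have : μ.IsMulRightInvariant := ⟨fun g => by
    rw [Measure.map_right_mul_eq_modularCharacterFun_smul, h.modularCharacterFun_eq_one, one_smul]⟩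
  exact isInvInvariant_of_isMulRightInvariant μ

end Haar

end IsControlledWeight

/-! ### From controlled weights to inequalities between norms -/

theorem eLpNorm_one_mul_le {α : Type*} [MeasurableSpace α] {ν : Measure α} {p q : ℝ≥0∞}
    [ENNReal.HolderTriple p q 1] {f : α → ℂ} {g : α → ℝ} (hf : AEStronglyMeasurable f ν)
    (hg : AEStronglyMeasurable g ν) :
    eLpNorm (fun x => f x * (g x : ℂ)) 1 ν ≤ eLpNorm f p ν * eLpNorm g q ν := by
  have := eLpNorm_le_eLpNorm_mul_eLpNorm_of_nnnorm (p := p) (q := q) (r := 1) hf hg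
    (fun z t => z * (t : ℂ)) 1 (ae_of_all _ fun x => by simp)
  simpa using this

/-- The inequalities on a weight `ω` from which everything about the algebra `Lᵖ(ω) ∩ L²` is
deduced. -/
structure IsDifferentialWeight {G : Type*} [Group G] [MeasurableSpace G] (μ : Measure G)
    (ω U : G → ℝ) (p : ℝ≥0∞) (K δ κ : ℝ) : Prop where
  isWeight : IsWeight ω
  measurable_bound : Measurable U
  bound_nonneg : ∀ x, 0 ≤ U x
  map_mul_le : ∀ x y, ω (x * y) ≤ ω x * ω y * (U x + U y)
  K_pos : 0 < K
  δ_pos : 0 < δ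
  κ_pos : 0 < κ
  eLpNorm_one_le : ∀ f : G → ℂ, AEStronglyMeasurable f μ →
    eLpNorm f 1 μ ≤ ENNReal.ofReal K * eLpNorm (fun x => f x * (ω x : ℂ)) p μ
  eLpNorm_mul_bound_le : ∀ f : G → ℂ, AEStronglyMeasurable f μ → ∀ R : ℝ, 1 ≤ R →
    eLpNorm (fun x => f x * (ω x : ℂ) * (U x : ℂ)) 1 μ ≤
      ENNReal.ofReal (K * R ^ (-δ)) * eLpNorm (fun x => f x * (ω x : ℂ)) p μ +
      ENNReal.ofReal (K * R ^ κ) * eLpNorm f 2 μ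
  eLpNorm_mul_bound_le' : ∀ f : G → ℂ, AEStronglyMeasurable f μ →
    eLpNorm (fun x => f x * (ω x : ℂ) * (U x : ℂ)) 1 μ ≤
      ENNReal.ofReal K * eLpNorm (fun x => f x * (ω x : ℂ)) p μ

namespace IsControlledWeight

variable {G : Type*} [Group G] [TopologicalSpace G] [IsTopologicalGroup G]
  [LocallyCompactSpace G] [T2Space G] [MeasurableSpace G] [BorelSpace G]
  {μ : Measure G} [μ.IsHaarMeasure] [μ.Regular] {ω u : G → ℝ} {s r c M : ℝ}
  (h : IsControlledWeight μ ω u s r c M)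

include h

/-- For q = ∞, integrability of u^s ω^r gives no uniform decay of u, so u is replaced by a multiple
of ω^(-r/s). Writing xy = (xv)(v⁻¹y) with v in a fixed sublevel set, v is chosen so that both
factors have small density. -/
theorem exists_pointwise_bound [μ.IsInvInvariant] :
    ∃ A : ℝ, 0 < A ∧ ∀ x y, ω (x * y) ≤
      ω x * ω y * (A * ω x ^ (-(r / s)) + A * ω y ^ (-(r / s))) := by
  have := h.sigmaCompactSpace
  obtain ⟨W, hW1, hW⟩ := h.exists_sublevel_mem_nhds
  have hpos : 0 < μ {x | ω x ≤ W} := Measure.measure_pos_of_mem_nhds μ hW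
  have hfin := h.measure_sublevel_lt_top W
  have hm : 0 < (μ {x | ω x ≤ W}).toReal := ENNReal.toReal_pos hpos.ne' hfin.ne
  have hW0 : 0 < W := by linarith
  set m := (μ {x | ω x ≤ W}).toReal with hm_def
  set I := ∫ x, u x ^ s * ω x ^ r ∂μ with hI_def
  have hI : 0 ≤ I := integral_nonneg fun x => (h.density_pos x).le
  -- The factor 2 appears because v must avoid two exceptional sets, each of measure at most I/K;
  -- their measures together stay below m.
  set K := 2 * (I + 1) / m with hK_def
  have hK : 0 < K := by positivity
  have hIK : ENNReal.ofReal (I / K) + ENNReal.ofReal (I / K) < μ {x | ω x ≤ W} := by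
    rw [← ENNReal.ofReal_add (by positivity) (by positivity),
      ENNReal.ofReal_lt_iff_lt_toReal (by positivity) hfin.ne, hK_def, div_div_eq_mul_div,
      ← add_div, div_lt_iff₀ (by positivity)]
    nlinarith
  set A := K ^ s⁻¹ * W ^ (r / s) with hA_def
  have hA : 0 < A := by positivity
  refine ⟨W ^ 2 * A, by positivity, fun x y => ?_⟩
  have hx0 := h.weight_pos x
  have hy0 := h.weight_pos y
  set E := {z | K ≤ u z ^ s * ω z ^ r} with hE_def
  have hE : MeasurableSet E := measurableSet_le measurable_const
    ((h.measurable_bound.pow_const s).mul (h.isWeight.measurable.pow_const r))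
  have hμE : μ E ≤ ENNReal.ofReal (I / K) := h.measure_le_of_density_ge hK fun z hz => hz
  obtain ⟨v, hv, hv1, hv2⟩ : ∃ v, ω v ≤ W ∧ x * v ∉ E ∧ v⁻¹ * y ∉ E := by
    by_contra! hcon
    have hsub : {x | ω x ≤ W} ⊆ (x * ·) ⁻¹' E ∪ (fun v => v⁻¹ * y) ⁻¹' E := by
      intro v hv
      by_cases hv1 : x * v ∈ E
      · exact Or.inl hv1
      · exact Or.inr (hcon v hv hv1)
    have h1 := (measure_mono hsub).trans (measure_union_le (μ := μ) _ _)
    rw [measure_preimage_mul,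
      (measurePreserving_inv_mul_const μ y).measure_preimage hE.nullMeasurableSet] at h1
    exact (h1.trans (add_le_add hμE hμE)).not_gt hIK
  simp only [hE_def, Set.mem_ofPred_eq, not_le] at hv1 hv2
  have hx1 : ω x ≤ W * ω (x * v) := by
    calc ω x = ω (x * v * v⁻¹) := by group
      _ ≤ ω (x * v) * ω v⁻¹ := h.isWeight.map_mul_le _ _
      _ ≤ ω (x * v) * W := by
        rw [h.isWeight.map_inv]
        exact mul_le_mul_of_nonneg_left hv (h.weight_pos _).le
      _ = W * ω (x * v) := mul_comm _ _
  have hy1 : ω y ≤ W * ω (v⁻¹ * y) := by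
    calc ω y = ω (v * (v⁻¹ * y)) := by group
      _ ≤ ω v * ω (v⁻¹ * y) := h.isWeight.map_mul_le _ _
      _ ≤ W * ω (v⁻¹ * y) := mul_le_mul_of_nonneg_right hv (h.weight_pos _).le
  have hx2 : ω (x * v) ≤ ω x * W :=
    (h.isWeight.map_mul_le _ _).trans (mul_le_mul_of_nonneg_left hv hx0.le)
  have hy2 : ω (v⁻¹ * y) ≤ W * ω y := by
    refine (h.isWeight.map_mul_le _ _).trans ?_
    rw [h.isWeight.map_inv]
    exact mul_le_mul_of_nonneg_right hv hy0.le
  have hua := h.bound_le_of_density_lt hW1 hv1 hx1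
  have hub := h.bound_le_of_density_lt hW1 hv2 hy1
  calc ω (x * y) = ω (x * v * (v⁻¹ * y)) := by group
    _ ≤ ω (x * v) * ω (v⁻¹ * y) * (u (x * v) + u (v⁻¹ * y)) := h.map_mul_le _ _
    _ ≤ (ω x * W) * (W * ω y) * (A * ω x ^ (-(r / s)) + A * ω y ^ (-(r / s))) := by
      refine mul_le_mul ?_ (add_le_add hua hub) ?_ (by positivity)
      · exact mul_le_mul hx2 hy2 (h.weight_pos _).le (by positivity)
      · exact (add_pos (h.bound_pos _) (h.bound_pos _)).le
    _ = _ := by ring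

/-- Tail estimate for the bound function in `L^q`. -/
theorem eLpNorm_indicator_bound_le {q : ℝ≥0∞} (hsq : ENNReal.ofReal s < q) (hq : q ≠ ∞) :
    ∃ C δ : ℝ, 0 < C ∧ 0 < δ ∧ ∀ R : ℝ, 1 ≤ R →
      eLpNorm ({x | R ≤ ω x}.indicator u) q μ ≤ ENNReal.ofReal (C * R ^ (-δ)) := by
  have hsq' : s < q.toReal := (ENNReal.ofReal_lt_iff_lt_toReal h.s_pos.le hq).1 hsq
  have hq0 : 0 < q.toReal := h.s_pos.trans hsq'
  have hI : 0 ≤ ∫ x, u x ^ s * ω x ^ r ∂μ := integral_nonneg fun x => (h.density_pos x).le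
  set I := ∫ x, u x ^ s * ω x ^ r ∂μ with hI_def
  have hM := h.M_pos
  refine ⟨(M ^ (q.toReal - s) * (I + 1)) ^ q.toReal⁻¹, r / q.toReal, by positivity,
    div_pos h.r_pos hq0, fun R hR => ?_⟩
  have hR0 : 0 < R := by linarith
  rw [eLpNorm_eq_lintegral_rpow_enorm_toReal (ENNReal.toReal_pos_iff.1 hq0).1.ne' hq]
  have h1 : ∫⁻ x, ‖{x | R ≤ ω x}.indicator u x‖ₑ ^ q.toReal ∂μ ≤
      ENNReal.ofReal (M ^ (q.toReal - s) * (I + 1) * R ^ (-r)) := by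
    calc ∫⁻ x, ‖{x | R ≤ ω x}.indicator u x‖ₑ ^ q.toReal ∂μ
        ≤ ∫⁻ x, ENNReal.ofReal (M ^ (q.toReal - s) * R ^ (-r) * (u x ^ s * ω x ^ r)) ∂μ := by
          refine lintegral_mono fun x => ?_
          by_cases hx : R ≤ ω x
          · have hu := h.bound_pos x
            rw [Set.indicator_of_mem (show x ∈ {x | R ≤ ω x} from hx),
              Real.enorm_of_nonneg hu.le, ENNReal.ofReal_rpow_of_nonneg hu.le hq0.le]
            refine ENNReal.ofReal_le_ofReal ?_
            -- Boundedness of u pays for the exponent q - s, and R^(-r) ω^r ≥ 1 on the tail pays for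
            -- the decay.
            have e1 : u x ^ q.toReal = u x ^ (q.toReal - s) * u x ^ s := by
              rw [← Real.rpow_add hu, sub_add_cancel]
            have e2 : 1 ≤ R ^ (-r) * ω x ^ r := by
              rw [Real.rpow_neg hR0.le, ← div_eq_inv_mul, one_le_div (by positivity)]
              exact Real.rpow_le_rpow hR0.le hx h.r_pos.le
            calc u x ^ q.toReal = u x ^ (q.toReal - s) * u x ^ s := e1
              _ ≤ M ^ (q.toReal - s) * u x ^ s * 1 := by
                rw [mul_one]
                exact mul_le_mul_of_nonneg_right
                  (Real.rpow_le_rpow hu.le (h.bound_le x) (by linarith)) (by positivity)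
              _ ≤ M ^ (q.toReal - s) * u x ^ s * (R ^ (-r) * ω x ^ r) :=
                mul_le_mul_of_nonneg_left e2 (by positivity)
              _ = _ := by ring
          · rw [Set.indicator_of_notMem (show x ∉ {x | R ≤ ω x} from hx), enorm_zero,
              ENNReal.zero_rpow_of_pos hq0]
            exact bot_le
      _ = ENNReal.ofReal (M ^ (q.toReal - s) * R ^ (-r) * I) := by
          rw [← integral_const_mul, ofReal_integral_eq_lintegral_ofReal (h.integrable.const_mul _)]
          exact ae_of_all _ fun x => mul_nonneg (by positivity) (h.density_pos x).le
      _ ≤ _ := by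
          refine ENNReal.ofReal_le_ofReal ?_
          have : 0 ≤ M ^ (q.toReal - s) * R ^ (-r) := by positivity
          nlinarith
  calc _ ≤ ENNReal.ofReal (M ^ (q.toReal - s) * (I + 1) * R ^ (-r)) ^ (1 / q.toReal) :=
        ENNReal.rpow_le_rpow h1 (by positivity)
    _ = _ := by
      rw [ENNReal.ofReal_rpow_of_nonneg (by positivity) (by positivity), one_div,
        Real.mul_rpow (by positivity) (by positivity), ← Real.rpow_mul hR0.le, neg_mul,
        div_eq_mul_inv]

/-- For q < ∞ the given u serves as U; for q = ∞ the function A ω^(-r/s) does. -/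
theorem exists_bound_function [μ.IsInvInvariant] {q : ℝ≥0∞} (hsq : ENNReal.ofReal s < q) :
    ∃ (U : G → ℝ) (B C δ : ℝ), Measurable U ∧ (∀ x, 0 ≤ U x) ∧ (∀ x, U x ≤ B) ∧
      (∀ x y, ω (x * y) ≤ ω x * ω y * (U x + U y)) ∧ 0 < B ∧ 0 < C ∧ 0 < δ ∧
      (∀ R : ℝ, 1 ≤ R →
        eLpNorm ({x | R ≤ ω x}.indicator U) q μ ≤ ENNReal.ofReal (C * R ^ (-δ))) ∧
      eLpNorm (fun x => (ω x)⁻¹) q μ ≤ ENNReal.ofReal C := by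
  rcases eq_or_ne q ∞ with rfl | hq
  · obtain ⟨A, hA, hAω⟩ := h.exists_pointwise_bound
    have hrs : 0 < r / s := div_pos h.r_pos h.s_pos
    have hle : ∀ x R, 0 < R → R ≤ ω x → A * ω x ^ (-(r / s)) ≤ A * R ^ (-(r / s)) :=
      fun x R hR hx => mul_le_mul_of_nonneg_left
        (Real.rpow_le_rpow_of_nonpos hR hx (by linarith)) hA.le
    refine ⟨fun x => A * ω x ^ (-(r / s)), A, max A 1, r / s,
      (h.isWeight.measurable.pow_const _).const_mul _, fun x => ?_, fun x => ?_, hAω, hA,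
      lt_max_of_lt_left hA, hrs, fun R hR => ?_, ?_⟩
    · have := h.weight_pos x
      positivity
    · simpa using hle x 1 one_pos (h.isWeight.one_le x)
    · have hR0 : 0 < R := by linarith
      rw [eLpNorm_exponent_top]
      refine eLpNormEssSup_le_of_ae_bound (ae_of_all _ fun x => ?_)
      by_cases hx : R ≤ ω x
      · have h0 := h.weight_pos x
        rw [Set.indicator_of_mem (show x ∈ {x | R ≤ ω x} from hx),
          Real.norm_of_nonneg (by positivity)]
        exact (hle x R hR0 hx).trans
          (mul_le_mul_of_nonneg_right (le_max_left _ _) (by positivity))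
      · rw [Set.indicator_of_notMem (show x ∉ {x | R ≤ ω x} from hx), norm_zero]
        positivity
    · rw [eLpNorm_exponent_top]
      refine eLpNormEssSup_le_of_ae_bound (ae_of_all _ fun x => ?_)
      rw [Real.norm_of_nonneg (inv_nonneg.2 (h.weight_pos x).le)]
      exact (inv_le_one_of_one_le₀ (h.isWeight.one_le x)).trans (le_max_right _ _)
  · obtain ⟨C, δ, hC, hδ, hCδ⟩ := h.eLpNorm_indicator_bound_le hsq hq
    have hc := h.c_pos
    refine ⟨u, M, max C (C / c), δ, h.measurable_bound, fun x => (h.bound_pos x).le, h.bound_le,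
      h.map_mul_le, h.M_pos, lt_max_of_lt_left hC, hδ, fun R hR => (hCδ R hR).trans ?_, ?_⟩
    · have hR0 : 0 < R := by linarith
      exact ENNReal.ofReal_le_ofReal
        (mul_le_mul_of_nonneg_right (le_max_left _ _) (by positivity))
    · have h1 := hCδ 1 le_rfl
      have huniv : {x | 1 ≤ ω x} = Set.univ := Set.eq_univ_of_forall h.isWeight.one_le
      rw [huniv, Set.indicator_univ, Real.one_rpow, mul_one] at h1
      calc eLpNorm (fun x => (ω x)⁻¹) q μ ≤ eLpNorm (c⁻¹ • u) q μ := by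
            refine eLpNorm_mono_real fun x => ?_
            have h0 := h.weight_pos x
            rw [Real.norm_of_nonneg (by positivity), Pi.smul_apply, smul_eq_mul,
              inv_le_iff_one_le_mul₀ h0, mul_assoc, ← div_eq_inv_mul, one_le_div hc, mul_comm]
            exact h.le_mul x
        _ ≤ ENNReal.ofReal (C / c) := by
            rw [eLpNorm_const_smul, Real.enorm_of_nonneg (by positivity), div_eq_inv_mul,
              ENNReal.ofReal_mul (by positivity)]
            exact mul_le_mul_right h1 _
        _ ≤ _ := ENNReal.ofReal_le_ofReal (le_max_right _ _)

/-- Membership of 1/ω in L^q embeds the weighted L^p space into L¹. The two-term bound comes from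
splitting fωU at ω = R, with Hölder on the tail and Cauchy–Schwarz on the rest. -/
theorem exists_isDifferentialWeight [μ.IsInvInvariant] {p q : ℝ≥0∞}
    (hpq : ENNReal.HolderConjugate p q) (hsq : ENNReal.ofReal s < q) :
    ∃ (U : G → ℝ) (K δ κ : ℝ), IsDifferentialWeight μ ω U p K δ κ := by
  obtain ⟨U, B, C, δ, hU, hU0, hUB, hmul, hB, hC, hδ, hR, hinv⟩ := h.exists_bound_function hsq
  obtain ⟨D, hD, hDR⟩ := h.exists_measure_sublevel_le
  have hωm := h.isWeight.measurable
  have hs := h.s_pos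
  set K := max C (B * D ^ (1 / 2 : ℝ)) with hK_def
  have hK : 0 < K := lt_max_of_lt_left hC
  have hofReal : Measurable fun x : ℝ => (x : ℂ) := Complex.measurable_ofReal
  have hfω : ∀ f : G → ℂ, AEStronglyMeasurable f μ →
      AEStronglyMeasurable (fun x => f x * (ω x : ℂ)) μ := fun f hf =>
    hf.mul (hofReal.comp hωm).aestronglyMeasurable
  -- On {ω < R} the function ωU is at most RB, and this set has measure at most D R^s. So its L²
  -- norm there is O(R^(1 + s/2)), which fixes κ.
  refine ⟨U, K, δ, 1 + s / 2, h.isWeight, hU, hU0, hmul, hK, hδ, by positivity,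
    fun f hf => ?_, fun f hf R hR1 => ?_, fun f hf => ?_⟩
  · calc eLpNorm f 1 μ = eLpNorm (fun x => f x * (ω x : ℂ) * (((ω x)⁻¹ : ℝ) : ℂ)) 1 μ := by
          congr 1
          ext x
          have : (ω x : ℂ) ≠ 0 := Complex.ofReal_ne_zero.2 (h.weight_pos x).ne'
          push_cast
          rw [mul_inv_cancel_right₀ this]
      _ ≤ eLpNorm (fun x => f x * (ω x : ℂ)) p μ * eLpNorm (fun x => (ω x)⁻¹) q μ :=
          eLpNorm_one_mul_le (hfω f hf) hωm.inv.aestronglyMeasurable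
      _ ≤ _ := by
          rw [mul_comm]
          exact mul_le_mul_left (hinv.trans (ENNReal.ofReal_le_ofReal (le_max_left _ _))) _
  · have hR0 : 0 < R := by linarith
    set E := {x | R ≤ ω x} with hE_def
    have hE : MeasurableSet E := measurableSet_le measurable_const hωm
    have hsplit : (fun x => f x * (ω x : ℂ) * (U x : ℂ)) =
        (fun x => f x * (ω x : ℂ) * ((E.indicator U x : ℝ) : ℂ)) +
        fun x => f x * ((Eᶜ.indicator (fun x => ω x * U x) x : ℝ) : ℂ) := by
      ext x
      by_cases hx : x ∈ E <;> simp [hx, mul_assoc]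
    have hm1 : Measurable (E.indicator U) := hU.indicator hE
    have hm2 : Measurable (Eᶜ.indicator fun x => ω x * U x) := (hωm.mul hU).indicator hE.compl
    rw [hsplit]
    refine (eLpNorm_add_le ((hfω f hf).mul (hofReal.comp hm1).aestronglyMeasurable)
      (hf.mul (hofReal.comp hm2).aestronglyMeasurable) le_rfl).trans (add_le_add ?_ ?_)
    · refine (eLpNorm_one_mul_le (p := p) (q := q) (hfω f hf) hm1.aestronglyMeasurable).trans ?_
      rw [mul_comm]
      refine mul_le_mul_left ((hR R hR1).trans (ENNReal.ofReal_le_ofReal ?_)) _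
      exact mul_le_mul_of_nonneg_right (le_max_left _ _) (by positivity)
    · refine (eLpNorm_one_mul_le (p := 2) (q := 2) hf hm2.aestronglyMeasurable).trans ?_
      rw [mul_comm]
      refine mul_le_mul_left ?_ _
      have h1 : eLpNorm (Eᶜ.indicator fun x => ω x * U x) 2 μ ≤
          eLpNorm (Eᶜ.indicator fun _ => R * B) 2 μ := by
        refine eLpNorm_mono_real fun x => ?_
        by_cases hx : x ∈ E
        · simp [hx]
        · have hx' : x ∈ Eᶜ := hx
          have hx'' : ω x ≤ R := (not_le.1 hx).le
          rw [Set.indicator_of_mem hx', Set.indicator_of_mem hx',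
            Real.norm_of_nonneg (mul_nonneg (h.weight_pos x).le (hU0 x))]
          exact mul_le_mul hx'' (hUB x) (hU0 x) hR0.le
      refine h1.trans ((eLpNorm_indicator_const_le _ _).trans ?_)
      have h2 : μ Eᶜ ≤ ENNReal.ofReal (D * R ^ s) :=
        (measure_mono (show Eᶜ ⊆ {x | ω x ≤ R} from fun x hx => (not_le.1 (show ¬R ≤ ω x from hx)).le)).trans (hDR R hR1)
      calc ‖R * B‖ₑ * μ Eᶜ ^ (1 / (2 : ℝ≥0∞).toReal)
          ≤ ENNReal.ofReal (R * B) * ENNReal.ofReal (D * R ^ s) ^ (1 / (2 : ℝ≥0∞).toReal) := by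
            rw [Real.enorm_of_nonneg (by positivity)]
            exact mul_le_mul_right (ENNReal.rpow_le_rpow h2 (by positivity)) _
        _ = ENNReal.ofReal (B * D ^ (1 / 2 : ℝ) * R ^ (1 + s / 2)) := by
            rw [ENNReal.toReal_ofNat, ENNReal.ofReal_rpow_of_nonneg (by positivity) (by positivity),
              ← ENNReal.ofReal_mul (by positivity), Real.mul_rpow hD.le (by positivity),
              ← Real.rpow_mul hR0.le, Real.rpow_add hR0, Real.rpow_one, mul_one_div]
            congr 1
            ring
        _ ≤ _ := ENNReal.ofReal_le_ofReal
            (mul_le_mul_of_nonneg_right (le_max_right _ _) (by positivity))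
  · have h1 := hR 1 le_rfl
    have huniv : {x | 1 ≤ ω x} = Set.univ := Set.eq_univ_of_forall h.isWeight.one_le
    rw [huniv, Set.indicator_univ, Real.one_rpow, mul_one] at h1
    refine (eLpNorm_one_mul_le (p := p) (q := q) (hfω f hf) hU.aestronglyMeasurable).trans ?_
    rw [mul_comm]
    exact mul_le_mul_left (h1.trans (ENNReal.ofReal_le_ofReal (le_max_left _ _))) _

end IsControlledWeight

/-! ### Completeness of the algebra -/

namespace WeightedLpL2

section Complete

variable {G : Type*} [MeasurableSpace G] {ω : G → ℝ} {p : ℝ≥0∞} {μ : Measure G}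

theorem weightedNorm_le_norm (f : WeightedLpL2 ω p μ) : weightedNorm f ≤ ‖f‖ := le_max_left _ _

theorem norm_toL2_le_norm (f : WeightedLpL2 ω p μ) : ‖toL2 f‖ ≤ ‖f‖ := le_max_right _ _

theorem eLpNorm_mul_weight (f : WeightedLpL2 ω p μ) :
    eLpNorm (fun x => toL2 f x * (ω x : ℂ)) p μ = ENNReal.ofReal (weightedNorm f) :=
  (ENNReal.ofReal_toReal f.memLp.2.ne).symm

theorem eLpNorm_toL2 (f : WeightedLpL2 ω p μ) :
    eLpNorm (toL2 f) 2 μ = ENNReal.ofReal ‖toL2 f‖ := by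
  rw [Lp.norm_def, ENNReal.ofReal_toReal (Lp.eLpNorm_ne_top _)]

/-- The element of `Lᵖ(ω) ∩ L²` given by a function. -/
noncomputable def ofFun (f : G → ℂ) (h2 : MemLp f 2 μ) (hω : MemLp (fun x => f x * (ω x : ℂ)) p μ) :
    WeightedLpL2 ω p μ :=
  (⟨h2.toLp f, hω.ae_eq (by filter_upwards [h2.coeFn_toLp] with x hx; rw [hx])⟩ :
    weightedSubmodule ω p μ)

theorem toL2_ofFun {f : G → ℂ} (h2 : MemLp f 2 μ) (hω : MemLp (fun x => f x * (ω x : ℂ)) p μ) :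
    toL2 (ofFun f h2 hω) = h2.toLp f := rfl

theorem weightedNorm_le_of_ae_eq {f : WeightedLpL2 ω p μ} {g : G → ℂ} (hfg : toL2 f =ᵐ[μ] g) {a : ℝ}
    (ha : 0 ≤ a) (h : eLpNorm (fun x => g x * (ω x : ℂ)) p μ ≤ ENNReal.ofReal a) :
    weightedNorm f ≤ a := by
  have h1 : (fun x => toL2 f x * (ω x : ℂ)) =ᵐ[μ] fun x => g x * (ω x : ℂ) := by
    filter_upwards [hfg] with x hx
    rw [hx]
  rw [weightedNorm, eLpNorm_congr_ae h1]
  exact ENNReal.toReal_le_of_le_ofReal ha h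

theorem norm_toL2_le_of_ae_eq {f : WeightedLpL2 ω p μ} {g : G → ℂ} (hfg : toL2 f =ᵐ[μ] g) {a : ℝ}
    (ha : 0 ≤ a) (h : eLpNorm g 2 μ ≤ ENNReal.ofReal a) : ‖toL2 f‖ ≤ a := by
  rw [Lp.norm_def, eLpNorm_congr_ae hfg]
  exact ENNReal.toReal_le_of_le_ofReal ha h

variable [Fact (1 ≤ p)]

/-- The isometric embedding of `Lᵖ(ω) ∩ L²` into `L² × Lᵖ`. -/
noncomputable def toProd (f : WeightedLpL2 ω p μ) : Lp ℂ 2 μ × Lp ℂ p μ :=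
  (toL2 f, f.memLp.toLp _)

theorem toProd_sub (f g : WeightedLpL2 ω p μ) : toProd (f - g) = toProd f - toProd g := by
  refine Prod.ext (map_sub toL2 f g) ?_
  change MemLp.toLp _ (f - g).memLp = MemLp.toLp _ f.memLp - MemLp.toLp _ g.memLp
  rw [← MemLp.toLp_sub, MemLp.toLp_eq_toLp_iff, map_sub]
  filter_upwards [Lp.coeFn_sub (toL2 f) (toL2 g)] with x hx
  rw [hx, Pi.sub_apply, Pi.sub_apply, sub_mul]

theorem isometry_toProd : Isometry (toProd : WeightedLpL2 ω p μ → Lp ℂ 2 μ × Lp ℂ p μ) := by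
  refine Isometry.of_dist_eq fun f g => ?_
  rw [dist_eq_norm, dist_eq_norm, ← toProd_sub, Prod.norm_def, norm_def, max_comm]
  congr 1
  exact Lp.norm_toLp _ (f - g).memLp

/-- Convergence in L² and in L^p both give almost everywhere convergence along a common subsequence,
which identifies the second limit as the first times ω. -/
theorem isClosed_range_toProd :
    IsClosed (Set.range (toProd : WeightedLpL2 ω p μ → Lp ℂ 2 μ × Lp ℂ p μ)) := by
  refine IsSeqClosed.isClosed fun a l ha hal => ?_
  choose f hf using ha
  obtain rfl : (fun n => toProd (f n)) = a := funext hf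
  have h2 : Tendsto (fun n => toL2 (f n)) atTop (𝓝 l.1) := (Prod.tendsto_iff _ _).1 hal |>.1
  have hp : Tendsto (fun n => (f n).memLp.toLp _) atTop (𝓝 l.2) := (Prod.tendsto_iff _ _).1 hal |>.2
  obtain ⟨n1, hn1, hlim1⟩ := (tendstoInMeasure_of_tendsto_Lp h2).exists_seq_tendsto_ae
  obtain ⟨n2, hn2, hlim2⟩ := (tendstoInMeasure_of_tendsto_Lp
    (hp.comp hn1.tendsto_atTop)).exists_seq_tendsto_ae
  have hcoe : ∀ᵐ x ∂μ, ∀ n, (f n).memLp.toLp _ x = toL2 (f n) x * (ω x : ℂ) :=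
    ae_all_iff.2 fun n => (f n).memLp.coeFn_toLp
  have hae : l.2 =ᵐ[μ] fun x => l.1 x * (ω x : ℂ) := by
    filter_upwards [hlim1, hlim2, hcoe] with x h1 h2 h3
    refine tendsto_nhds_unique h2 ?_
    have h4 := (h1.comp hn2.tendsto_atTop).mul_const (ω x : ℂ)
    refine h4.congr fun i => ?_
    simp only [comp_apply]
    exact (h3 _).symm
  let g : WeightedLpL2 ω p μ :=
    (⟨l.1, (memLp_congr_ae hae).1 (Lp.memLp l.2)⟩ : weightedSubmodule ω p μ)
  exact ⟨g, Prod.ext rfl (Lp.ext (g.memLp.coeFn_toLp.trans hae.symm))⟩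

theorem completeSpace : CompleteSpace (WeightedLpL2 ω p μ) :=
  (completeSpace_iff_isComplete_range isometry_toProd.isUniformInducing).2
    isClosed_range_toProd.isComplete

end Complete

end WeightedLpL2

/-! ### Convolution operators on L² -/

section LeftConvolution

variable {G : Type*} [Group G] [TopologicalSpace G] [IsTopologicalGroup G]
  [LocallyCompactSpace G] [T2Space G] [SigmaCompactSpace G] [MeasurableSpace G] [BorelSpace G]
  {μ : Measure G} [μ.IsHaarMeasure] [μ.Regular] [μ.IsInvInvariant]

theorem groupConv_add_ae {f g g' : G → ℂ} (hf : MemLp f 1 μ) (hg : MemLp g 2 μ)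
    (hg' : MemLp g' 2 μ) :
    groupConv μ f (g + g') =ᵐ[μ] groupConv μ f g + groupConv μ f g' := by
  filter_upwards [(isConvolution_groupConv μ hf one_le_two ENNReal.ofNat_ne_top hg).1,
    (isConvolution_groupConv μ hf one_le_two ENNReal.ofNat_ne_top hg').1] with x h1 h2
  simp only [groupConv, Pi.add_apply, mul_add]
  exact integral_add h1 h2

theorem add_groupConv_ae {f f' g : G → ℂ} (hf : MemLp f 1 μ) (hf' : MemLp f' 1 μ)
    (hg : MemLp g 2 μ) :
    groupConv μ (f + f') g =ᵐ[μ] groupConv μ f g + groupConv μ f' g := by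
  filter_upwards [(isConvolution_groupConv μ hf one_le_two ENNReal.ofNat_ne_top hg).1,
    (isConvolution_groupConv μ hf' one_le_two ENNReal.ofNat_ne_top hg).1] with x h1 h2
  simp only [groupConv, Pi.add_apply, add_mul]
  exact integral_add h1 h2

theorem groupConv_smul (f g : G → ℂ) (c : ℂ) :
    groupConv μ f (c • g) = c • groupConv μ f g := by
  ext x
  simp only [groupConv, Pi.smul_apply, smul_eq_mul, mul_left_comm _ c, integral_const_mul]

theorem smul_groupConv (f g : G → ℂ) (c : ℂ) :
    groupConv μ (c • f) g = c • groupConv μ f g := by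
  ext x
  simp only [groupConv, Pi.smul_apply, smul_eq_mul, mul_assoc, integral_const_mul]

/-- Convolution from the left by an integrable function, as an operator on `L²`. -/
noncomputable def leftConv (f : G → ℂ) (hf : MemLp f 1 μ) : Lp ℂ 2 μ →L[ℂ] Lp ℂ 2 μ :=
  LinearMap.mkContinuous
    { toFun := fun g =>
        (memLp_groupConv μ hf one_le_two ENNReal.ofNat_ne_top (Lp.memLp g)).toLp _
      map_add' := fun g g' => by
        rw [← MemLp.toLp_add, MemLp.toLp_eq_toLp_iff, groupConv_congr μ (ae_eq_refl f)
          (Lp.coeFn_add g g')]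
        exact groupConv_add_ae hf (Lp.memLp g) (Lp.memLp g')
      map_smul' := fun c g => by
        rw [RingHom.id_apply, ← MemLp.toLp_const_smul, MemLp.toLp_eq_toLp_iff,
          groupConv_congr μ (ae_eq_refl f) (Lp.coeFn_smul c g), groupConv_smul] }
    (eLpNorm f 1 μ).toReal
    fun g => by
      simp only [LinearMap.coe_mk, AddHom.coe_mk]
      rw [Lp.norm_toLp, Lp.norm_def, ← ENNReal.toReal_mul]
      exact ENNReal.toReal_mono (ENNReal.mul_ne_top hf.2.ne (Lp.eLpNorm_ne_top g))
        (eLpNorm_groupConv_le μ hf.1 (Lp.memLp g).1 one_le_two ENNReal.ofNat_ne_top)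

theorem coeFn_leftConv {f : G → ℂ} (hf : MemLp f 1 μ) (g : Lp ℂ 2 μ) :
    leftConv f hf g =ᵐ[μ] groupConv μ f g :=
  MemLp.coeFn_toLp (memLp_groupConv μ hf one_le_two ENNReal.ofNat_ne_top (Lp.memLp g))

theorem norm_leftConv_le {f : G → ℂ} (hf : MemLp f 1 μ) :
    ‖leftConv f hf‖ ≤ (eLpNorm f 1 μ).toReal :=
  LinearMap.mkContinuous_norm_le _ ENNReal.toReal_nonneg _

theorem adjoint_leftConv {f : G → ℂ} (hf : MemLp f 1 μ) :
    ContinuousLinearMap.adjoint (leftConv f hf) = leftConv (convStar f) (memLp_convStar μ hf) := by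
  symm
  rw [ContinuousLinearMap.eq_adjoint_iff]
  intro k g
  have h1 : (inner ℂ (leftConv f hf g) k : ℂ) =
      inner ℂ g (leftConv (convStar f) (memLp_convStar μ hf) k) := by
    rw [L2.inner_def, L2.inner_def]
    have e1 : ∫ x, (inner ℂ (leftConv f hf g x) (k x) : ℂ) ∂μ =
        ∫ x, starRingEnd ℂ (groupConv μ f g x) * k x ∂μ := by
      refine integral_congr_ae ?_
      filter_upwards [coeFn_leftConv hf g] with x hx
      rw [hx, RCLike.inner_apply, mul_comm]
    have e2 : ∫ x, (inner ℂ (g x) (leftConv (convStar f) (memLp_convStar μ hf) k x) : ℂ) ∂μ =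
        ∫ x, starRingEnd ℂ (g x) * groupConv μ (convStar f) k x ∂μ := by
      refine integral_congr_ae ?_
      filter_upwards [coeFn_leftConv (memLp_convStar μ hf) k] with x hx
      rw [hx, RCLike.inner_apply, mul_comm]
    rw [e1, e2]
    exact integral_conj_groupConv_mul μ hf (Lp.memLp g) (Lp.memLp k)
  rw [← inner_conj_symm, ← h1, inner_conj_symm]

end LeftConvolution

/-! ### Faithfulness and separation from the scalars -/

section LowerBounds

variable {G : Type*} [Group G] [TopologicalSpace G] [IsTopologicalGroup G]
  [LocallyCompactSpace G] [T2Space G] [SigmaCompactSpace G] [MeasurableSpace G] [BorelSpace G]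
  {μ : Measure G} [μ.IsHaarMeasure] [μ.Regular] [μ.IsInvInvariant]

theorem continuous_groupConv {f g : G → ℂ} (hf : MemLp f 1 μ) (hg : Continuous g)
    (hgc : HasCompactSupport g) : Continuous (groupConv μ f g) := by
  rw [continuous_iff_continuousAt]
  intro x₀
  obtain ⟨s, hs, hsx⟩ := exists_compact_mem_nhds x₀
  have hk : IsCompact (Set.image2 (fun x y => x * y⁻¹) s (tsupport g)) := by
    rw [← Set.image_prod]
    exact (hs.prod hgc).image (by fun_prop)
  refine (continuousOn_integral_bilinear_of_locally_integrable_of_compact_support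
    (ContinuousLinearMap.mul ℂ ℂ) (f := fun x y => g (y⁻¹ * x)) hk ?_ ?_
    (memLp_one_iff_integrable.1 hf).integrableOn).continuousAt hsx
  · exact (hg.comp (by fun_prop : Continuous fun z : G × G => z.2⁻¹ * z.1)).continuousOn
  · intro x y hx hy
    by_contra hne
    refine hy ⟨x, hx, y⁻¹ * x, subset_tsupport g hne, ?_⟩
    group

/-- For g in C_c, f * g is continuous and vanishes almost everywhere, hence everywhere. Its value at
1 shows that f annihilates C_c, which is dense in L². -/
theorem eq_zero_of_leftConv_eq_zero {f : Lp ℂ 2 μ} (hf : MemLp f 1 μ)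
    (h : leftConv f hf = 0) : f = 0 := by
  have hC : ∀ g : G → ℂ, Continuous g → HasCompactSupport g → ∫ y, f y * g y ∂μ = 0 := by
    intro g hg hgc
    have hg' : Continuous fun y => g y⁻¹ := hg.comp continuous_inv
    have hgc' : HasCompactSupport fun y => g y⁻¹ := hgc.comp_homeomorph (Homeomorph.inv G)
    have hmem : MemLp (fun y => g y⁻¹) 2 μ := hg'.memLp_of_hasCompactSupport hgc'
    have h1 : groupConv μ f (fun y => g y⁻¹) =ᵐ[μ] fun _ => 0 := by
      rw [← groupConv_congr μ (ae_eq_refl f) hmem.coeFn_toLp]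
      refine (coeFn_leftConv hf (hmem.toLp _)).symm.trans ?_
      rw [h]
      exact Lp.coeFn_zero ℂ 2 μ
    have h2 := congrFun ((continuous_groupConv hf hg' hgc').ae_eq_iff_eq μ continuous_const |>.1 h1) 1
    simpa [groupConv] using h2
  by_contra hne
  have hpos : 0 < ‖f‖ := norm_pos_iff.2 hne
  obtain ⟨g, hgc, hgf, hg, hgm⟩ := (Lp.memLp f).exists_hasCompactSupport_eLpNorm_sub_le
    (p := 2) ENNReal.ofNat_ne_top (ε := ENNReal.ofReal (‖f‖ / 2)) (by simpa using hpos)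
  have h1 : (inner ℂ (hgm.toLp g) f : ℂ) = 0 := by
    rw [L2.inner_def, ← hC (fun y => starRingEnd ℂ (g y)) (Complex.continuous_conj.comp hg)
      (hgc.comp_left (map_zero _))]
    refine integral_congr_ae ?_
    filter_upwards [hgm.coeFn_toLp] with x hx
    rw [hx, RCLike.inner_apply]
  have h2 : ‖f - hgm.toLp g‖ ≤ ‖f‖ / 2 := by
    rw [Lp.norm_def]
    refine ENNReal.toReal_le_of_le_ofReal (by positivity) ?_
    rw [eLpNorm_congr_ae ((Lp.coeFn_sub f _).trans ((ae_eq_refl _).sub hgm.coeFn_toLp))]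
    exact hgf
  have h3 : (inner ℂ f f : ℂ) = inner ℂ (f - hgm.toLp g) f := by
    rw [inner_sub_left, h1, sub_zero]
  have h4 : ‖f‖ ^ 2 ≤ ‖f‖ / 2 * ‖f‖ := by
    have h5 := norm_inner_le_norm (𝕜 := ℂ) (f - hgm.toLp g) f
    rw [← h3, inner_self_eq_norm_sq_to_K] at h5
    simp only [norm_pow, RCLike.norm_ofReal, abs_norm] at h5
    exact h5.trans (mul_le_mul_of_nonneg_right h2 hpos.le)
  nlinarith

/-- On a non-discrete group points are Haar null, and outer regularity at {1} gives small open sets.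
-/
theorem exists_measure_pos_lt (hG : ¬DiscreteTopology G) {ε : ℝ≥0∞} (hε : 0 < ε) :
    ∃ V : Set G, MeasurableSet V ∧ 0 < μ V ∧ μ V < ε := by
  have hne : (𝓝[≠] (1 : G)).NeBot := by
    rw [neBot_iff]
    intro h
    exact hG (discreteTopology_of_isOpen_singleton_one ((isOpen_singleton_iff_punctured_nhds 1).2 h))
  have := Measure.IsHaarMeasure.nullSingletonClass (G := G) μ
  obtain ⟨V, hV1, hV, hVε⟩ := Set.exists_isOpen_lt_of_lt ({1} : Set G) ε
    (μ := μ) (by rwa [measure_singleton])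
  exact ⟨V, hV.measurableSet, hV.measure_pos μ ⟨1, hV1 rfl⟩, hVε⟩

/-- On a non-discrete group, left convolution operators by square-integrable functions are far from
nonzero scalars. -/
theorem norm_le_norm_leftConv_add_smul (hG : ¬DiscreteTopology G) {f : Lp ℂ 2 μ} (hf : MemLp f 1 μ)
    (t : ℂ) : ‖t‖ ≤ ‖leftConv f hf + t • (1 : Lp ℂ 2 μ →L[ℂ] Lp ℂ 2 μ)‖ := by
  set T := leftConv f hf + t • (1 : Lp ℂ 2 μ →L[ℂ] Lp ℂ 2 μ) with hT
  refine le_of_forall_pos_le_add fun ε hε => ?_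
  obtain ⟨V, hV, hV0, hVε⟩ := exists_measure_pos_lt (μ := μ) hG
    (ε := ENNReal.ofReal ((ε / (‖f‖ + 1)) ^ 2)) (by rw [ENNReal.ofReal_pos]; positivity)
  have hfin : μ V ≠ ∞ := (hVε.trans ENNReal.ofReal_lt_top).ne
  set m := (μ V).toReal with hm_def
  have hm : 0 < m := ENNReal.toReal_pos hV0.ne' hfin
  have hmε : m ≤ (ε / (‖f‖ + 1)) ^ 2 := ENNReal.toReal_le_of_le_ofReal (by positivity) hVε.le
  have hsq : √m ≤ ε / (‖f‖ + 1) := Real.sqrt_le_iff.2 ⟨by positivity, hmε⟩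
  have hs0 : 0 < √m := Real.sqrt_pos.2 hm
  -- The test vector is 1_V with V small: ‖f * 1_V‖₂ ≤ ‖f‖₂ μ(V), while ‖1_V‖₂ = √μ(V), so λ(f) is
  -- negligible on it and only t remains.
  let g : Lp ℂ 2 μ := indicatorConstLp 2 hV hfin 1
  have hg : ‖g‖ = √m := by
    rw [norm_indicatorConstLp two_ne_zero ENNReal.ofNat_ne_top, norm_one, one_mul,
      Real.sqrt_eq_rpow, ENNReal.toReal_ofNat]
    rfl
  have hfg : ‖leftConv f hf g‖ ≤ ‖f‖ * m := by
    rw [Lp.norm_def, Lp.norm_def, hm_def, ← ENNReal.toReal_mul]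
    refine ENNReal.toReal_mono (ENNReal.mul_ne_top (Lp.eLpNorm_ne_top f) hfin) ?_
    rw [eLpNorm_congr_ae (coeFn_leftConv hf g)]
    refine (eLpNorm_groupConv_le' μ hf.1 (Lp.memLp g).1 one_le_two ENNReal.ofNat_ne_top).trans ?_
    refine mul_le_mul_right ?_ _
    rw [eLpNorm_congr_ae indicatorConstLp_coeFn]
    refine (eLpNorm_indicator_const_le _ _).trans_eq ?_
    simp
  have h1 : t • g = T g - leftConv f hf g := by
    rw [hT]
    simp
  have h2 : ‖t‖ * √m ≤ ‖T‖ * √m + ‖f‖ * m := by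
    rw [← hg, ← norm_smul, h1]
    refine (norm_sub_le _ _).trans (add_le_add (T.le_opNorm g) hfg)
  have h3 : ‖f‖ * √m ≤ ε := by
    calc ‖f‖ * √m ≤ (‖f‖ + 1) * (ε / (‖f‖ + 1)) :=
          mul_le_mul (by linarith) hsq hs0.le (by positivity)
      _ = ε := by field_simp
  have h4 : ‖f‖ * m = ‖f‖ * √m * √m := by rw [mul_assoc, Real.mul_self_sqrt hm.le]
  rw [h4, ← add_mul] at h2
  linarith [le_of_mul_le_mul_right h2 hs0]

end LowerBounds

/-! ### The Banach algebra structure and the differential inequality -/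

namespace IsDifferentialWeight

open WeightedLpL2

variable {G : Type*} [Group G] [TopologicalSpace G] [IsTopologicalGroup G]
  [LocallyCompactSpace G] [T2Space G] [SigmaCompactSpace G] [MeasurableSpace G] [BorelSpace G]
  {μ : Measure G} [μ.IsHaarMeasure] [μ.Regular] [μ.IsInvInvariant]
  {ω U : G → ℝ} {p : ℝ≥0∞} {K δ κ : ℝ} (h : IsDifferentialWeight μ ω U p K δ κ)

include h

theorem eLpNorm_toL2_one_le (f : WeightedLpL2 ω p μ) :
    eLpNorm (toL2 f) 1 μ ≤ ENNReal.ofReal (K * ‖f‖) := by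
  refine (h.eLpNorm_one_le _ (Lp.memLp (toL2 f)).1).trans ?_
  rw [eLpNorm_mul_weight, ← ENNReal.ofReal_mul h.K_pos.le]
  exact ENNReal.ofReal_le_ofReal
    (mul_le_mul_of_nonneg_left (weightedNorm_le_norm f) h.K_pos.le)

theorem memLp_one (f : WeightedLpL2 ω p μ) : MemLp (toL2 f) 1 μ :=
  ⟨(Lp.memLp (toL2 f)).1, (h.eLpNorm_toL2_one_le f).trans_lt ENNReal.ofReal_lt_top⟩

theorem measurable_weight_complex : Measurable fun x => (ω x : ℂ) :=
  Complex.measurable_ofReal.comp h.isWeight.measurable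

theorem measurable_bound_complex : Measurable fun x => (U x : ℂ) :=
  Complex.measurable_ofReal.comp h.measurable_bound

/-- The weighted norm of a convolution. -/
theorem eLpNorm_groupConv_mul_weight_le {f g : G → ℂ} (hf : AEStronglyMeasurable f μ)
    (hg : AEStronglyMeasurable g μ) (hp : 1 ≤ p) (hp' : p ≠ ∞) :
    eLpNorm (fun x => groupConv μ f g x * (ω x : ℂ)) p μ ≤
      eLpNorm (fun x => f x * (ω x : ℂ) * (U x : ℂ)) 1 μ *
        eLpNorm (fun x => g x * (ω x : ℂ)) p μ +
      eLpNorm (fun x => f x * (ω x : ℂ)) p μ *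
        eLpNorm (fun x => g x * (ω x : ℂ) * (U x : ℂ)) 1 μ := by
  have hω := h.measurable_weight_complex.aestronglyMeasurable (μ := μ)
  have hU := h.measurable_bound_complex.aestronglyMeasurable (μ := μ)
  have hfω := hf.mul hω
  have hgω := hg.mul hω
  have hfU := hfω.mul hU
  have hgU := hgω.mul hU
  set F1 := mlconvolution (fun x => ‖f x * (ω x : ℂ) * (U x : ℂ)‖ₑ) (fun x => ‖g x * (ω x : ℂ)‖ₑ) μ
    with hF1
  set F2 := mlconvolution (fun x => ‖f x * (ω x : ℂ)‖ₑ) (fun x => ‖g x * (ω x : ℂ) * (U x : ℂ)‖ₑ) μ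
    with hF2
  have hF1m : Measurable F1 := measurable_mlconvolution μ hfU.enorm hgω.enorm
  have hF2m : Measurable F2 := measurable_mlconvolution μ hfω.enorm hgU.enorm
  have hpt : ∀ x, ‖groupConv μ f g x * (ω x : ℂ)‖ₑ ≤ ‖(F1 + F2) x‖ₑ := by
    intro x
    rw [enorm_eq_self, Pi.add_apply, enorm_mul]
    have hωe : ∀ y, ‖(ω y : ℂ)‖ₑ = ENNReal.ofReal (ω y) := fun y => by
      rw [← Real.enorm_of_nonneg (h.isWeight.nonneg y)]
      simp [enorm]
    have hUe : ∀ y, ‖(U y : ℂ)‖ₑ = ENNReal.ofReal (U y) := fun y => by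
      rw [← Real.enorm_of_nonneg (h.bound_nonneg y)]
      simp [enorm]
    calc ‖groupConv μ f g x‖ₑ * ‖(ω x : ℂ)‖ₑ
        ≤ mlconvolution (fun y => ‖f y‖ₑ) (fun y => ‖g y‖ₑ) μ x * ‖(ω x : ℂ)‖ₑ :=
          mul_le_mul_left (enorm_groupConv_le μ f g x) _
      _ = ∫⁻ y, ‖f y‖ₑ * ‖g (y⁻¹ * x)‖ₑ * ‖(ω x : ℂ)‖ₑ ∂μ :=
          (lintegral_mul_const' _ _ enorm_ne_top).symm
      _ ≤ ∫⁻ y, (‖f y * (ω y : ℂ) * (U y : ℂ)‖ₑ * ‖g (y⁻¹ * x) * (ω (y⁻¹ * x) : ℂ)‖ₑ +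
            ‖f y * (ω y : ℂ)‖ₑ *
              ‖g (y⁻¹ * x) * (ω (y⁻¹ * x) : ℂ) * (U (y⁻¹ * x) : ℂ)‖ₑ) ∂μ := by
          refine lintegral_mono fun y => ?_
          -- The two terms U(y) and U(y⁻¹x) give two convolutions, with U attached to f and to g;
          -- each is estimated by the half of Young's inequality that puts this factor in L¹.
          have h1 := h.map_mul_le y (y⁻¹ * x)
          rw [mul_inv_cancel_left] at h1
          have h2 := ENNReal.ofReal_le_ofReal h1
          rw [ENNReal.ofReal_mul (mul_nonneg (h.isWeight.nonneg _) (h.isWeight.nonneg _)),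
            ENNReal.ofReal_mul (h.isWeight.nonneg _),
            ENNReal.ofReal_add (h.bound_nonneg _) (h.bound_nonneg _)] at h2
          simp only [enorm_mul, hωe, hUe]
          calc ‖f y‖ₑ * ‖g (y⁻¹ * x)‖ₑ * ENNReal.ofReal (ω x)
              ≤ ‖f y‖ₑ * ‖g (y⁻¹ * x)‖ₑ * _ := mul_le_mul_right h2 _
            _ = _ := by ring
      _ = F1 x + F2 x := by
          have hm := (hfU.enorm.mul (hgω.enorm.comp_quasiMeasurePreserving
            (measurePreserving_inv_mul_const μ x).quasiMeasurePreserving))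
          exact lintegral_add_left' hm _
  refine (eLpNorm_mono_enorm hpt).trans ?_
  refine (eLpNorm_add_le hF1m.aestronglyMeasurable hF2m.aestronglyMeasurable hp).trans ?_
  exact add_le_add (eLpNorm_mlconvolution_enorm_le μ hfU hgω hp hp')
    (eLpNorm_mlconvolution_enorm_le' μ hfω hgU hp hp')

variable [Fact (1 ≤ p)]

theorem eLpNorm_toL2_mul_bound_le (f : WeightedLpL2 ω p μ) {R : ℝ} (hR : 1 ≤ R) :
    eLpNorm (fun x => toL2 f x * (ω x : ℂ) * (U x : ℂ)) 1 μ ≤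
      ENNReal.ofReal (K * (R ^ (-δ) * ‖f‖ + R ^ κ * ‖toL2 f‖)) := by
  have hK := h.K_pos
  have hR0 : 0 < R := by linarith
  have hw : 0 ≤ weightedNorm f := ENNReal.toReal_nonneg
  refine (h.eLpNorm_mul_bound_le _ (Lp.memLp (toL2 f)).1 R hR).trans ?_
  rw [eLpNorm_mul_weight, eLpNorm_toL2, ← ENNReal.ofReal_mul (by positivity),
    ← ENNReal.ofReal_mul (by positivity), ← ENNReal.ofReal_add
    (mul_nonneg (by positivity) hw) (by positivity)]
  refine ENNReal.ofReal_le_ofReal ?_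
  have h1 := mul_le_mul_of_nonneg_left (weightedNorm_le_norm f)
    (by positivity : 0 ≤ K * R ^ (-δ))
  linarith

theorem eLpNorm_toL2_mul_bound_le' (f : WeightedLpL2 ω p μ) :
    eLpNorm (fun x => toL2 f x * (ω x : ℂ) * (U x : ℂ)) 1 μ ≤ ENNReal.ofReal (K * ‖f‖) := by
  refine (h.eLpNorm_mul_bound_le' _ (Lp.memLp (toL2 f)).1).trans ?_
  rw [eLpNorm_mul_weight, ← ENNReal.ofReal_mul h.K_pos.le]
  exact ENNReal.ofReal_le_ofReal
    (mul_le_mul_of_nonneg_left (weightedNorm_le_norm f) h.K_pos.le)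

theorem memLp_groupConv_mul_weight (hp : p ≠ ∞) (f g : WeightedLpL2 ω p μ) :
    MemLp (fun x => groupConv μ (toL2 f) (toL2 g) x * (ω x : ℂ)) p μ := by
  have hf := (Lp.memLp (toL2 f)).1
  have hg := (Lp.memLp (toL2 g)).1
  refine ⟨(stronglyMeasurable_groupConv μ hf hg).aestronglyMeasurable.mul
    h.measurable_weight_complex.aestronglyMeasurable, ?_⟩
  refine (h.eLpNorm_groupConv_mul_weight_le hf hg Fact.out hp).trans_lt ?_
  exact ENNReal.add_lt_top.2
    ⟨ENNReal.mul_lt_top ((h.eLpNorm_toL2_mul_bound_le' f).trans_lt ENNReal.ofReal_lt_top) g.memLp.2,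
    ENNReal.mul_lt_top f.memLp.2 ((h.eLpNorm_toL2_mul_bound_le' g).trans_lt ENNReal.ofReal_lt_top)⟩

/-- The convolution integral defines an element of A, so the default value 0 in the product is never
used. -/
theorem isConvolution_mul (hp : p ≠ ∞) (f g : WeightedLpL2 ω p μ) :
    IsConvolution μ (toL2 f) (toL2 g) (toL2 (f * g)) := by
  have hex : ∃ k : WeightedLpL2 ω p μ, IsConvolution μ (toL2 f) (toL2 g) (toL2 k) := by
    have h2 := memLp_groupConv μ (h.memLp_one f) one_le_two ENNReal.ofNat_ne_top (Lp.memLp (toL2 g))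
    refine ⟨ofFun _ h2 (h.memLp_groupConv_mul_weight hp f g), ?_, ?_⟩
    · exact (isConvolution_groupConv μ (h.memLp_one f) one_le_two ENNReal.ofNat_ne_top
        (Lp.memLp (toL2 g))).1
    · rw [toL2_ofFun]
      exact h2.coeFn_toLp
  have hmul : f * g = hex.choose := dif_pos hex
  rw [hmul]
  exact hex.choose_spec

theorem toL2_mul_ae (hp : p ≠ ∞) (f g : WeightedLpL2 ω p μ) :
    toL2 (f * g) =ᵐ[μ] groupConv μ (toL2 f) (toL2 g) := (h.isConvolution_mul hp f g).2

theorem norm_toL2_mul_le (hp : p ≠ ∞) (f g : WeightedLpL2 ω p μ) :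
    ‖toL2 (f * g)‖ ≤ K * ‖f‖ * ‖toL2 g‖ := by
  have hK := h.K_pos
  refine norm_toL2_le_of_ae_eq (h.toL2_mul_ae hp f g) (by positivity) ?_
  refine (eLpNorm_groupConv_le μ (h.memLp_one f).1 (Lp.memLp (toL2 g)).1 one_le_two
    ENNReal.ofNat_ne_top).trans ?_
  rw [eLpNorm_toL2, ENNReal.ofReal_mul (by positivity)]
  exact mul_le_mul_left (h.eLpNorm_toL2_one_le f) _

/-- The bounds a and b stay free: crude ones give submultiplicativity, and R-dependent ones the
differential inequality. -/
theorem weightedNorm_mul_le (hp : p ≠ ∞) (f g : WeightedLpL2 ω p μ) {a b : ℝ} (ha : 0 ≤ a)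
    (hb : 0 ≤ b)
    (haf : eLpNorm (fun x => toL2 f x * (ω x : ℂ) * (U x : ℂ)) 1 μ ≤ ENNReal.ofReal a)
    (hbg : eLpNorm (fun x => toL2 g x * (ω x : ℂ) * (U x : ℂ)) 1 μ ≤ ENNReal.ofReal b) :
    weightedNorm (f * g) ≤ a * ‖g‖ + ‖f‖ * b := by
  refine weightedNorm_le_of_ae_eq (h.toL2_mul_ae hp f g) (by positivity) ?_
  refine (h.eLpNorm_groupConv_mul_weight_le (Lp.memLp (toL2 f)).1 (Lp.memLp (toL2 g)).1
    Fact.out hp).trans ?_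
  rw [ENNReal.ofReal_add (by positivity) (by positivity), ENNReal.ofReal_mul ha,
    ENNReal.ofReal_mul (norm_nonneg f), eLpNorm_mul_weight, eLpNorm_mul_weight]
  exact add_le_add (mul_le_mul' haf (ENNReal.ofReal_le_ofReal (weightedNorm_le_norm g)))
    (mul_le_mul' (ENNReal.ofReal_le_ofReal (weightedNorm_le_norm f)) hbg)

theorem norm_mul_le (hp : p ≠ ∞) (f g : WeightedLpL2 ω p μ) : ‖f * g‖ ≤ 2 * K * ‖f‖ * ‖g‖ := by
  have hK := h.K_pos
  refine max_le ?_ ?_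
  · refine (h.weightedNorm_mul_le hp f g (by positivity) (by positivity)
      (h.eLpNorm_toL2_mul_bound_le' f) (h.eLpNorm_toL2_mul_bound_le' g)).trans_eq (by ring)
  · refine (h.norm_toL2_mul_le hp f g).trans ?_
    have h1 := mul_le_mul_of_nonneg_left (norm_toL2_le_norm g) (by positivity : 0 ≤ K * ‖f‖)
    have h2 : 0 ≤ K * ‖f‖ * ‖g‖ := by positivity
    linarith

/-- The differential inequality: the norm of a square is controlled by the weaker `L²` norm. -/
theorem norm_mul_self_le (hp : p ≠ ∞) (f : WeightedLpL2 ω p μ) {R : ℝ} (hR : 1 ≤ R) :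
    ‖f * f‖ ≤ 2 * K * ‖f‖ * (R ^ (-δ) * ‖f‖ + R ^ κ * ‖toL2 f‖) := by
  have hK := h.K_pos
  have hR0 : 0 < R := by linarith
  refine max_le ?_ ?_
  · refine (h.weightedNorm_mul_le hp f f (by positivity) (by positivity)
      (h.eLpNorm_toL2_mul_bound_le f hR) (h.eLpNorm_toL2_mul_bound_le f hR)).trans_eq (by ring)
  · refine (h.norm_toL2_mul_le hp f f).trans ?_
    have h1 : 1 ≤ R ^ κ := Real.one_le_rpow hR h.κ_pos.le
    have h2 : 0 ≤ R ^ (-δ) * ‖f‖ := by positivity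
    have h3 : ‖toL2 f‖ ≤ R ^ (-δ) * ‖f‖ + R ^ κ * ‖toL2 f‖ := by
      nlinarith [norm_nonneg (toL2 f)]
    have h4 : 0 ≤ K * ‖f‖ * (R ^ (-δ) * ‖f‖ + R ^ κ * ‖toL2 f‖) := by positivity
    have h5 := mul_le_mul_of_nonneg_left h3 (by positivity : 0 ≤ K * ‖f‖)
    linarith

/-- The interpolated form of the differential inequality. -/
theorem norm_mul_self_le_rpow (hp : p ≠ ∞) (f : WeightedLpL2 ω p μ) :
    ‖f * f‖ ≤ 4 * K * (‖f‖ ^ (2 - δ / (δ + κ)) * ‖toL2 f‖ ^ (δ / (δ + κ))) := by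
  have hK := h.K_pos
  have hδ := h.δ_pos
  have hκ := h.κ_pos
  -- The choice of R below divides by ‖f‖₂, so f = 0 is treated apart.
  rcases (norm_nonneg (toL2 f)).eq_or_lt with h0 | h0
  · have hf0 : f = 0 := toL2_injective (by rw [norm_eq_zero.1 h0.symm, map_zero])
    have h1 := h.norm_mul_le hp f f
    rw [hf0, norm_zero, mul_zero] at h1
    rw [hf0]
    exact h1.trans (by positivity)
  have hf : 0 < ‖f‖ := h0.trans_le (norm_toL2_le_norm f)
  set a := ‖f‖ with ha_def
  set b := ‖toL2 f‖ with hb_def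
  have hab : 1 ≤ a / b := (one_le_div h0).2 (norm_toL2_le_norm f)
  have habpos : 0 < a / b := by positivity
  -- This R makes R^(-δ)‖f‖ and R^κ‖f‖₂ equal; R ≥ 1 because ‖f‖₂ ≤ ‖f‖.
  have h1 := h.norm_mul_self_le hp f (R := (a / b) ^ (δ + κ)⁻¹)
    (Real.one_le_rpow hab (by positivity))
  set θ := δ / (δ + κ) with hθ_def
  have e1 : ((a / b) ^ (δ + κ)⁻¹) ^ (-δ) * a = a ^ (1 - θ) * b ^ θ := by
    rw [← Real.rpow_mul habpos.le, show (δ + κ)⁻¹ * -δ = -θ by rw [hθ_def]; ring,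
      Real.rpow_neg habpos.le, Real.div_rpow hf.le h0.le, Real.rpow_sub hf, Real.rpow_one]
    field_simp
  have e2 : ((a / b) ^ (δ + κ)⁻¹) ^ κ * b = a ^ (1 - θ) * b ^ θ := by
    rw [← Real.rpow_mul habpos.le, show (δ + κ)⁻¹ * κ = 1 - θ by
      rw [hθ_def]; field_simp; ring, Real.div_rpow hf.le h0.le, Real.rpow_sub h0, Real.rpow_one]
    field_simp
  rw [e1, e2] at h1
  refine h1.trans_eq ?_
  have e3 : a ^ (2 - θ) = a * a ^ (1 - θ) := by
    rw [show 2 - θ = 1 + (1 - θ) by ring, Real.rpow_add hf, Real.rpow_one]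
  rw [e3]
  ring

end IsDifferentialWeight

/-! ### Decay under repeated squaring -/

section RealSequences

/-- Repeated squaring with a differential inequality converges to zero. -/
theorem tendsto_zero_of_differential_inequality {x y : ℕ → ℝ} {l θ C : ℝ} (hl0 : 0 < l)
    (hl1 : l < 1) (hθ : 0 < θ) (hθ1 : θ ≤ 1) (hC : 0 ≤ C) (hx0 : ∀ k, 0 ≤ x k)
    (hy0 : ∀ k, 0 ≤ y k)
    (hx : ∀ k, x (k + 1) ≤ C * (x k ^ (2 - θ) * y k ^ θ) + 2 * l ^ 2 ^ k * x k)
    (hy : ∀ k, y (k + 1) ≤ 2 * l ^ 2 ^ k * y k) : Tendsto x atTop (𝓝 0) := by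
  have hlk : ∀ k : ℕ, 0 < l ^ 2 ^ k := fun k => by positivity
  have hlsucc : ∀ k : ℕ, l ^ 2 ^ (k + 1) = l ^ 2 ^ k * l ^ 2 ^ k := fun k => by
    rw [pow_succ 2 k, mul_two, pow_add]
  set V := max (y 0 / l) 1 with hV
  have hV1 : 1 ≤ V := le_max_right _ _
  have hyk : ∀ k : ℕ, y k / l ^ 2 ^ k ≤ 2 ^ k * V := by
    intro k
    induction k with
    | zero => simpa using (show y 0 / l ≤ V from le_max_left _ _)
    | succ k ih =>
      have h1 := hlk k
      rw [div_le_iff₀ h1] at ih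
      rw [div_le_iff₀ (hlk _), hlsucc]
      refine (hy k).trans ?_
      calc 2 * l ^ 2 ^ k * y k ≤ 2 * l ^ 2 ^ k * (2 ^ k * V * l ^ 2 ^ k) :=
            mul_le_mul_of_nonneg_left ih (by positivity)
        _ = _ := by ring
  -- Dividing by l^(2^k), which squares at each step, leaves W_{k+1} ≤ B 2^k W_k^(2-θ). The
  -- truncation at 1 keeps log W nonnegative and W ≤ W^(2-θ).
  set W : ℕ → ℝ := fun k => max (x k / l ^ 2 ^ k) 1 with hW
  have hW1 : ∀ k, 1 ≤ W k := fun k => le_max_right _ _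
  have hW0 : ∀ k, 0 < W k := fun k => one_pos.trans_le (hW1 k)
  set B := C * V + 2 with hB
  have hB1 : 1 ≤ B := by
    have : 0 ≤ C * V := by positivity
    linarith
  have hWstep : ∀ k, W (k + 1) ≤ B * 2 ^ k * W k ^ (2 - θ) := by
    intro k
    have h2k : (1 : ℝ) ≤ 2 ^ k := one_le_pow₀ one_le_two
    have hWθ : 1 ≤ W k ^ (2 - θ) := Real.one_le_rpow (hW1 k) (by linarith)
    have hWle : W k ≤ W k ^ (2 - θ) := by
      nth_rw 1 [← Real.rpow_one (W k)]
      exact Real.rpow_le_rpow_of_exponent_le (hW1 k) (by linarith)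
    refine max_le ?_ (one_le_mul_of_one_le_of_one_le (one_le_mul_of_one_le_of_one_le hB1 h2k) hWθ)
    have hl := hlk k
    set q := l ^ 2 ^ k with hq
    have ex : x k = x k / q * q := by field_simp
    have ey : y k = y k / q * q := by field_simp
    have hxq : 0 ≤ x k / q := div_nonneg (hx0 k) hl.le
    have hyq : 0 ≤ y k / q := div_nonneg (hy0 k) hl.le
    have hqq : q ^ (2 - θ) * q ^ θ = q * q := by
      rw [← Real.rpow_add hl, sub_add_cancel, Real.rpow_two, sq]
    have h2kV : 1 ≤ 2 ^ k * V := one_le_mul_of_one_le_of_one_le h2k hV1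
    have hyθ : (y k / q) ^ θ ≤ 2 ^ k * V := by
      calc (y k / q) ^ θ ≤ (2 ^ k * V) ^ θ := Real.rpow_le_rpow hyq (hyk k) hθ.le
        _ ≤ (2 ^ k * V) ^ (1 : ℝ) := Real.rpow_le_rpow_of_exponent_le h2kV hθ1
        _ = 2 ^ k * V := Real.rpow_one _
    have hxθ : (x k / q) ^ (2 - θ) ≤ W k ^ (2 - θ) :=
      Real.rpow_le_rpow hxq (le_max_left _ _) (by linarith)
    rw [hlsucc, div_le_iff₀ (by positivity)]
    have e1 : x k ^ (2 - θ) * y k ^ θ = (x k / q) ^ (2 - θ) * (y k / q) ^ θ * (q * q) := by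
      rw [Real.div_rpow (hx0 k) hl.le, Real.div_rpow (hy0 k) hl.le, ← hqq]
      have := Real.rpow_pos_of_pos hl (2 - θ)
      have := Real.rpow_pos_of_pos hl θ
      field_simp
    calc x (k + 1) ≤ C * (x k ^ (2 - θ) * y k ^ θ) + 2 * q * x k := hx k
      _ = (C * ((x k / q) ^ (2 - θ) * (y k / q) ^ θ) + 2 * (x k / q)) * (q * q) := by
        rw [e1]
        field_simp
      _ ≤ (C * (W k ^ (2 - θ) * (2 ^ k * V)) + 2 * 2 ^ k * W k ^ (2 - θ)) * (q * q) := by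
        refine mul_le_mul_of_nonneg_right (add_le_add ?_ ?_) (by positivity)
        · exact mul_le_mul_of_nonneg_left (mul_le_mul hxθ hyθ (by positivity) (by positivity)) hC
        · have h3 : x k / q ≤ W k ^ (2 - θ) := (le_max_left _ _).trans hWle
          nlinarith
      _ = B * 2 ^ k * W k ^ (2 - θ) * (q * q) := by rw [hB]; ring
  have hlog2 : 0 ≤ Real.log 2 := Real.log_nonneg one_le_two
  have hlogB : 0 ≤ Real.log B := Real.log_nonneg hB1
  have htend := tendsto_div_two_pow_of_le (L := fun k => Real.log (W k))
    (c := Real.log 2 + Real.log B) (fun k => Real.log_nonneg (hW1 k)) hθ hθ1 (fun k => by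
      have hWk := hW0 k
      have h1 := Real.log_le_log (hW0 (k + 1)) (hWstep k)
      rw [Real.log_mul (by positivity) (by positivity), Real.log_mul (by positivity)
        (by positivity), Real.log_rpow hWk, Real.log_pow] at h1
      have hk : (0 : ℝ) ≤ k := Nat.cast_nonneg k
      nlinarith [mul_nonneg hk hlogB])
  have hlogl : Real.log l < 0 := Real.log_neg hl0 hl1
  -- Since log W_k = o(2^k), eventually W_k costs at most half of the exponent in l^(2^k).
  have hev : ∀ᶠ k : ℕ in atTop, x k ≤ (√l) ^ 2 ^ k := by
    filter_upwards [htend.eventually (gt_mem_nhds (show (0 : ℝ) < -Real.log l / 2 by linarith))]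
      with k hk
    have hWk := hW0 k
    rw [div_lt_iff₀ (by positivity)] at hk
    have h1 : x k ≤ W k * l ^ 2 ^ k := by
      rw [← div_le_iff₀ (hlk k)]
      exact le_max_left _ _
    refine h1.trans ((Real.log_le_log_iff (by positivity) (by positivity)).1 ?_)
    rw [Real.log_mul (by positivity) (by positivity), Real.log_pow, Real.log_pow,
      Real.log_sqrt hl0.le]
    push_cast
    linarith
  refine squeeze_zero' (Eventually.of_forall hx0) hev ?_
  have hs1 : √l < 1 := by
    rw [Real.sqrt_lt' one_pos]
    simpa using hl1
  exact (tendsto_pow_atTop_nhds_zero_of_lt_one (Real.sqrt_nonneg l) hs1).comp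
    (tendsto_pow_atTop_atTop_of_one_lt one_lt_two)

end RealSequences

/-! ### Reduction of invertibility to a norm bound -/

section Hilbert

variable {E : Type*} [NormedAddCommGroup E] [InnerProductSpace ℂ E] [CompleteSpace E]

/-- If `X` is invertible then a suitable `1 - c X X†` has norm less than one. -/
theorem exists_norm_one_sub_smul_mul_adjoint_le {X S : E →L[ℂ] E} (hXS : X * S = 1) :
    ∃ c l : ℝ, 0 < c ∧ 0 < l ∧ l < 1 ∧
      ‖1 - (c : ℂ) • (X * ContinuousLinearMap.adjoint X)‖ ≤ l := by
  set X' := ContinuousLinearMap.adjoint X with hX'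
  -- With c‖X‖² ≤ 1 the quadratic term in ‖v - cXX*v‖² is at most half of the cross term 2c‖X*v‖²,
  -- leaving ‖v‖² - c‖X*v‖². As ‖v‖ ≤ ‖S‖‖X*v‖, this is at most (1 - a)‖v‖² for the a below.
  set c := (‖X‖ ^ 2 + 1)⁻¹ with hc
  have hc0 : 0 < c := by positivity
  have hcX : c * ‖X‖ ^ 2 ≤ 1 := by
    rw [hc, inv_mul_le_iff₀ (by positivity)]
    linarith
  have hc1 : c ≤ 1 := inv_le_one_of_one_le₀ (by nlinarith [sq_nonneg ‖X‖])
  set a := c / (‖S‖ ^ 2 + 1) with ha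
  have ha0 : 0 < a := by positivity
  have ha1 : a ≤ 1 := by
    rw [ha, div_le_one (by positivity)]
    nlinarith [sq_nonneg ‖S‖]
  have hsq : √(1 - a) < 1 := by
    rw [Real.sqrt_lt' one_pos]
    linarith
  -- The maximum with 1/2 only ensures l > 0.
  refine ⟨c, max (√(1 - a)) (1 / 2), hc0, lt_max_of_lt_right (by norm_num),
    max_lt hsq (by norm_num), ?_⟩
  refine ContinuousLinearMap.opNorm_le_bound _ (by positivity) fun v => ?_
  have hv : ‖v‖ ^ 2 ≤ (‖S‖ ^ 2 + 1) * ‖X' v‖ ^ 2 := by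
    have h1 : ContinuousLinearMap.adjoint S * X' = 1 := by
      rw [hX', ← ContinuousLinearMap.star_eq_adjoint, ← ContinuousLinearMap.star_eq_adjoint,
        ← star_mul, hXS, star_one]
    have h2 : v = ContinuousLinearMap.adjoint S (X' v) := by
      rw [← mul_apply_eq_comp, h1, one_apply_eq_self]
    have h3 : ‖v‖ ≤ ‖S‖ * ‖X' v‖ := by
      have h4 := (ContinuousLinearMap.adjoint S).le_opNorm (X' v)
      rwa [← h2, LinearIsometryEquiv.norm_map] at h4
    calc ‖v‖ ^ 2 ≤ (‖S‖ * ‖X' v‖) ^ 2 := pow_le_pow_left₀ (norm_nonneg v) h3 2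
      _ ≤ _ := by nlinarith [sq_nonneg ‖X' v‖]
  have hY : (1 - (c : ℂ) • (X * X')) v = v - (c : ℂ) • X (X' v) := by simp
  have hexp : ‖v - (c : ℂ) • X (X' v)‖ ^ 2 =
      ‖v‖ ^ 2 - 2 * c * ‖X' v‖ ^ 2 + c ^ 2 * ‖X (X' v)‖ ^ 2 := by
    rw [norm_sub_sq (𝕜 := ℂ), inner_smul_right, ← ContinuousLinearMap.adjoint_inner_left X,
      inner_self_eq_norm_sq_to_K, norm_smul]
    simp only [Complex.norm_real, Real.norm_of_nonneg hc0.le, RCLike.re_to_complex]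
    have : ((c : ℂ) * ((‖X' v‖ : ℝ) : ℂ) ^ 2).re = c * ‖X' v‖ ^ 2 := by
      rw [← Complex.ofReal_pow, ← Complex.ofReal_mul, Complex.ofReal_re]
    rw [mul_pow]
    have h2 : ((c : ℂ) * (RCLike.ofReal ‖X' v‖ : ℂ) ^ 2).re = c * ‖X' v‖ ^ 2 := this
    rw [h2]
    ring
  have hXX : ‖X (X' v)‖ ^ 2 ≤ ‖X‖ ^ 2 * ‖X' v‖ ^ 2 := by
    rw [← mul_pow]
    exact pow_le_pow_left₀ (norm_nonneg _) (X.le_opNorm _) 2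
  have hmain : ‖v - (c : ℂ) • X (X' v)‖ ^ 2 ≤ (1 - a) * ‖v‖ ^ 2 := by
    rw [hexp]
    have h1 : c ^ 2 * ‖X (X' v)‖ ^ 2 ≤ c * ‖X' v‖ ^ 2 := by
      calc c ^ 2 * ‖X (X' v)‖ ^ 2 ≤ c ^ 2 * (‖X‖ ^ 2 * ‖X' v‖ ^ 2) :=
            mul_le_mul_of_nonneg_left hXX (by positivity)
        _ = c * (c * ‖X‖ ^ 2) * ‖X' v‖ ^ 2 := by ring
        _ ≤ c * 1 * ‖X' v‖ ^ 2 := by gcongr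
        _ = _ := by ring
    have h2 : a * ‖v‖ ^ 2 ≤ c * ‖X' v‖ ^ 2 := by
      rw [ha, div_mul_eq_mul_div, div_le_iff₀ (by positivity)]
      nlinarith
    nlinarith
  rw [hY]
  calc ‖v - (c : ℂ) • X (X' v)‖ ≤ √((1 - a) * ‖v‖ ^ 2) := Real.le_sqrt_of_sq_le hmain
    _ = √(1 - a) * ‖v‖ := by rw [Real.sqrt_mul (by linarith), Real.sqrt_sq (norm_nonneg v)]
    _ ≤ _ := mul_le_mul_of_nonneg_right (le_max_left _ _) (norm_nonneg v)

end Hilbert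

/-! ### The regular representation and inverse-closedness -/

namespace IsDifferentialWeight

open WeightedLpL2

variable {G : Type*} [Group G] [TopologicalSpace G] [IsTopologicalGroup G]
  [LocallyCompactSpace G] [T2Space G] [SigmaCompactSpace G] [MeasurableSpace G] [BorelSpace G]
  {μ : Measure G} [μ.IsHaarMeasure] [μ.Regular] [μ.IsInvInvariant]
  {ω U : G → ℝ} {p : ℝ≥0∞} {K δ κ : ℝ} (h : IsDifferentialWeight μ ω U p K δ κ)

/-- The left regular representation of `Lᵖ(ω) ∩ L²` on `L²`. -/
noncomputable def leftOp : WeightedLpL2 ω p μ →ₗ[ℂ] (Lp ℂ 2 μ →L[ℂ] Lp ℂ 2 μ) where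
  toFun f := leftConv (toL2 f) (h.memLp_one f)
  map_add' f f' := by
    refine ContinuousLinearMap.ext fun g => Lp.ext ?_
    rw [add_apply]
    refine (coeFn_leftConv _ g).trans (EventuallyEq.trans ?_ (Lp.coeFn_add _ _).symm)
    rw [map_add, groupConv_congr μ (Lp.coeFn_add (toL2 f) (toL2 f')) (ae_eq_refl _)]
    exact (add_groupConv_ae (h.memLp_one f) (h.memLp_one f') (Lp.memLp g)).trans
      ((coeFn_leftConv _ g).symm.add (coeFn_leftConv _ g).symm)
  map_smul' c f := by
    refine ContinuousLinearMap.ext fun g => Lp.ext ?_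
    rw [RingHom.id_apply, smul_apply]
    refine (coeFn_leftConv _ g).trans (EventuallyEq.trans ?_ (Lp.coeFn_smul _ _).symm)
    rw [map_smul, groupConv_congr μ (Lp.coeFn_smul c (toL2 f)) (ae_eq_refl _), smul_groupConv]
    exact (coeFn_leftConv _ g).symm.const_smul c

theorem coeFn_leftOp (f : WeightedLpL2 ω p μ) (g : Lp ℂ 2 μ) :
    h.leftOp f g =ᵐ[μ] groupConv μ (toL2 f) g := coeFn_leftConv (h.memLp_one f) g

theorem leftOp_injective : Injective h.leftOp := by
  refine (injective_iff_map_eq_zero _).2 fun f hf => toL2_injective ?_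
  rw [map_zero]
  exact eq_zero_of_leftConv_eq_zero (h.memLp_one f) hf

theorem norm_leftOp_le [Fact (1 ≤ p)] (f : WeightedLpL2 ω p μ) : ‖h.leftOp f‖ ≤ K * ‖f‖ :=
  (norm_leftConv_le (h.memLp_one f)).trans
    (ENNReal.toReal_le_of_le_ofReal (mul_nonneg h.K_pos.le (norm_nonneg f))
      (h.eLpNorm_toL2_one_le f))

theorem leftOp_apply_toL2 [Fact (1 ≤ p)] (hp : p ≠ ∞) (f g : WeightedLpL2 ω p μ) :
    h.leftOp f (toL2 g) = toL2 (f * g) :=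
  Lp.ext ((h.coeFn_leftOp f _).trans (h.toL2_mul_ae hp f g).symm)

theorem leftOp_mul [Fact (1 ≤ p)] (hp : p ≠ ∞) (f g : WeightedLpL2 ω p μ) :
    h.leftOp (f * g) = h.leftOp f * h.leftOp g := by
  refine ContinuousLinearMap.ext fun k => Lp.ext ?_
  rw [mul_apply_eq_comp]
  refine (h.coeFn_leftOp _ k).trans (EventuallyEq.trans ?_ (h.coeFn_leftOp f _).symm)
  rw [groupConv_congr μ (h.toL2_mul_ae hp f g) (ae_eq_refl _),
    groupConv_congr μ (ae_eq_refl (toL2 f)) (h.coeFn_leftOp g k)]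
  exact groupConv_assoc μ (h.memLp_one f) (h.memLp_one g) one_le_two ENNReal.ofNat_ne_top
    (Lp.memLp k)

/-- A is closed under f*(x) = conj f(x⁻¹), because ω is symmetric and μ is inversion invariant. -/
theorem exists_leftOp_eq_adjoint (f : WeightedLpL2 ω p μ) :
    ∃ g, h.leftOp g = ContinuousLinearMap.adjoint (h.leftOp f) := by
  have hω : MemLp (fun x => convStar (toL2 f) x * (ω x : ℂ)) p μ := by
    have h1 := memLp_convStar μ f.memLp
    convert h1 using 2 with x
    simp [convStar, h.isWeight.map_inv]
  have h2 := memLp_convStar μ (Lp.memLp (toL2 f))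
  refine ⟨ofFun _ h2 hω, ?_⟩
  change _ = ContinuousLinearMap.adjoint (leftConv (toL2 f) (h.memLp_one f))
  rw [adjoint_leftConv]
  refine ContinuousLinearMap.ext fun k => Lp.ext ?_
  refine (h.coeFn_leftOp _ k).trans (EventuallyEq.trans ?_ (coeFn_leftConv _ k).symm)
  rw [toL2_ofFun, groupConv_congr μ h2.coeFn_toLp (ae_eq_refl _)]

/-- The representation `(f, t) ↦ (g ↦ f * g + t g)` of the unitization of `Lᵖ(ω) ∩ L²`. -/
noncomputable def unitizationOp :
    Unitization ℂ (WeightedLpL2 ω p μ) →ₗ[ℂ] (Lp ℂ 2 μ →L[ℂ] Lp ℂ 2 μ) where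
  toFun a := h.leftOp a.snd + a.fst • 1
  map_add' a b := by
    rw [Unitization.snd_add, Unitization.fst_add, map_add, add_smul]
    abel
  map_smul' c a := by
    rw [Unitization.snd_smul, Unitization.fst_smul, map_smul, smul_add, smul_eq_mul, mul_smul,
      RingHom.id_apply]

theorem unitizationOp_apply (a : Unitization ℂ (WeightedLpL2 ω p μ)) :
    h.unitizationOp a = h.leftOp a.snd + a.fst • 1 := rfl

theorem unitizationOp_one : h.unitizationOp 1 = 1 := by
  rw [unitizationOp_apply, Unitization.snd_one, Unitization.fst_one, map_zero, zero_add, one_smul]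

theorem norm_fst_le (hG : ¬DiscreteTopology G) (a : Unitization ℂ (WeightedLpL2 ω p μ)) :
    ‖a.fst‖ ≤ ‖h.unitizationOp a‖ :=
  norm_le_norm_leftConv_add_smul hG (h.memLp_one a.snd) a.fst

theorem unitizationOp_injective (hG : ¬DiscreteTopology G) : Injective h.unitizationOp := by
  refine (injective_iff_map_eq_zero _).2 fun a ha => ?_
  have h1 := h.norm_fst_le hG a
  rw [ha, norm_zero, norm_le_zero_iff] at h1
  rw [unitizationOp_apply, h1, zero_smul, add_zero] at ha
  refine Unitization.ext h1 (h.leftOp_injective ?_)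
  rw [ha, Unitization.snd_zero, map_zero]

variable [Fact (1 ≤ p)]

theorem norm_unitizationOp_le (a : Unitization ℂ (WeightedLpL2 ω p μ)) :
    ‖h.unitizationOp a‖ ≤ max K 1 * unitizationNorm a := by
  have h1 : ‖a.fst • (1 : Lp ℂ 2 μ →L[ℂ] Lp ℂ 2 μ)‖ ≤ 1 * ‖a.fst‖ := by
    rw [norm_smul, one_mul]
    exact mul_le_of_le_one_right (norm_nonneg _) ContinuousLinearMap.norm_id_le
  rw [unitizationOp_apply, unitizationNorm, mul_add]
  refine (norm_add_le _ _).trans (add_le_add ((h.norm_leftOp_le _).trans ?_) (h1.trans ?_))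
  · exact mul_le_mul_of_nonneg_right (le_max_left _ _) (norm_nonneg _)
  · exact mul_le_mul_of_nonneg_right (le_max_right _ _) (norm_nonneg _)

theorem unitizationOp_mul (hp : p ≠ ∞) (a b : Unitization ℂ (WeightedLpL2 ω p μ)) :
    h.unitizationOp (a * b) = h.unitizationOp a * h.unitizationOp b := by
  simp only [unitizationOp_apply, Unitization.snd_mul, Unitization.fst_mul, map_add, map_smul,
    h.leftOp_mul hp]
  rw [add_mul, mul_add, mul_add, smul_mul_smul_comm, one_mul, smul_mul_assoc, one_mul,
    mul_smul_comm, mul_one]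
  abel

theorem exists_unitizationOp_eq_adjoint (a : Unitization ℂ (WeightedLpL2 ω p μ)) :
    ∃ b, h.unitizationOp b = ContinuousLinearMap.adjoint (h.unitizationOp a) := by
  obtain ⟨g, hg⟩ := h.exists_leftOp_eq_adjoint a.snd
  refine ⟨⟨(starRingEnd ℂ a.fst, g)⟩, ?_⟩
  rw [unitizationOp_apply, unitizationOp_apply, map_add, ← hg, LinearIsometryEquiv.map_smulₛₗ]
  congr 2
  rw [← ContinuousLinearMap.star_eq_adjoint, star_one]

theorem exists_unitizationOp_eq_pow (hp : p ≠ ∞) (a : Unitization ℂ (WeightedLpL2 ω p μ)) (n : ℕ) :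
    ∃ b, h.unitizationOp b = h.unitizationOp a ^ n := by
  induction n with
  | zero => exact ⟨1, by rw [unitizationOp_one, pow_zero]⟩
  | succ n ih =>
    obtain ⟨b, hb⟩ := ih
    exact ⟨b * a, by rw [h.unitizationOp_mul hp, hb, pow_succ]⟩

include h in
-- Algebraic identities in A are read off from the faithful representation instead of being proved
-- for convolution.
theorem mul_sub_mul (hp : p ≠ ∞) (d e e' : WeightedLpL2 ω p μ) :
    d * e - d * e' = d * (e - e') := by
  refine h.leftOp_injective ?_
  rw [map_sub, h.leftOp_mul hp, h.leftOp_mul hp, h.leftOp_mul hp, map_sub, mul_sub]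

/-- A small perturbation of the identity has a right inverse in the algebra. -/
theorem exists_one_sub_mul_eq_one (hp : p ≠ ∞) (d : WeightedLpL2 ω p μ) (t : ℂ)
    (hd : 2 * K * ‖d‖ + ‖t‖ < 1) :
    ∃ b, (1 - (h.leftOp d + t • 1)) * h.unitizationOp b = 1 := by
  have hK := h.K_pos
  have : CompleteSpace (WeightedLpL2 ω p μ) := completeSpace
  -- A right inverse of 1 - d - t must have scalar part (1 - t)⁻¹; its A-part e is then exactly a
  -- fixed point of T.
  let T : WeightedLpL2 ω p μ → WeightedLpL2 ω p μ := fun e => d * e + t • e + (1 - t)⁻¹ • d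
  have hT : ContractingWith (2 * K * ‖d‖ + ‖t‖).toNNReal T := by
    refine ⟨Real.toNNReal_lt_one.2 hd, LipschitzWith.of_dist_le_mul fun e e' => ?_⟩
    rw [dist_eq_norm, dist_eq_norm]
    have h1 : T e - T e' = d * (e - e') + t • (e - e') := by
      simp only [T]
      rw [← h.mul_sub_mul hp, smul_sub]
      abel
    rw [h1]
    refine (norm_add_le _ _).trans ?_
    rw [norm_smul, Real.coe_toNNReal _ (by positivity), add_mul]
    exact add_le_add_left (h.norm_mul_le hp d _) _
  have ht : (1 : ℂ) - t ≠ 0 := by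
    intro h0
    have h1 : ‖t‖ = 1 := by rw [← sub_eq_zero.1 h0, norm_one]
    have h2 : 0 ≤ 2 * K * ‖d‖ := by positivity
    linarith
  obtain ⟨e, he⟩ : ∃ e, T e = e := ⟨hT.fixedPoint T, hT.fixedPoint_isFixedPt⟩
  have h1 := congrArg h.leftOp he
  simp only [T, map_add, map_smul, h.leftOp_mul hp] at h1
  refine ⟨⟨((1 - t)⁻¹, e)⟩, ?_⟩
  have h2 : h.unitizationOp ⟨((1 - t)⁻¹, e)⟩ = h.leftOp e + (1 - t)⁻¹ • 1 := rfl
  rw [h2]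
  have h3 : (1 - t)⁻¹ • (1 : Lp ℂ 2 μ →L[ℂ] Lp ℂ 2 μ) - t • (1 - t)⁻¹ • 1 = 1 := by
    rw [smul_smul, ← sub_smul, ← one_sub_mul, mul_inv_cancel₀ ht, one_smul]
  calc (1 - (h.leftOp d + t • 1)) * (h.leftOp e + (1 - t)⁻¹ • 1)
      = h.leftOp e - (h.leftOp d * h.leftOp e + t • h.leftOp e + (1 - t)⁻¹ • h.leftOp d) +
        ((1 - t)⁻¹ • 1 - t • (1 - t)⁻¹ • 1) := by
        simp only [sub_mul, add_mul, mul_add, one_mul, smul_mul_assoc, mul_smul_comm, mul_one]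
        module
    _ = 1 := by rw [h1, sub_self, zero_add, h3]

/-- Elements whose image has norm less than one have small iterated squares in the algebra. -/
theorem exists_pow_eq_small (hp : p ≠ ∞) (hG : ¬DiscreteTopology G)
    (a : Unitization ℂ (WeightedLpL2 ω p μ)) {l : ℝ} (hl0 : 0 < l) (hl1 : l < 1)
    (ha : ‖h.unitizationOp a‖ ≤ l) :
    ∃ (n : ℕ) (d : WeightedLpL2 ω p μ) (t : ℂ),
      h.unitizationOp a ^ n = h.leftOp d + t • 1 ∧ 2 * K * ‖d‖ + ‖t‖ < 1 := by
  have hK := h.K_pos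
  have hδ := h.δ_pos
  have hκ := h.κ_pos
  have hat : ‖a.fst‖ ≤ l := (h.norm_fst_le hG a).trans ha
  -- H_k is the A-part of the 2^k-th power of a: squaring f + τ gives f * f + 2τf + τ².
  let H : ℕ → WeightedLpL2 ω p μ := fun k => Nat.rec a.snd
    (fun k f => f * f + (2 * a.fst ^ 2 ^ k) • f) k
  have hH : ∀ k, H (k + 1) = H k * H k + (2 * a.fst ^ 2 ^ k) • H k := fun k => rfl
  have hpow : ∀ k, h.unitizationOp a ^ 2 ^ k = h.leftOp (H k) + a.fst ^ 2 ^ k • 1 := by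
    intro k
    induction k with
    | zero =>
      rw [pow_zero, pow_one, pow_one]
      rfl
    | succ k ih =>
      rw [pow_succ 2 k, mul_two, pow_add, ih, hH, map_add, map_smul, h.leftOp_mul hp, pow_add]
      simp only [add_mul, mul_add, one_mul, smul_mul_assoc, mul_smul_comm, mul_one, smul_smul,
        two_mul, add_smul, smul_add]
      abel
  have hpl : ∀ k, ‖h.unitizationOp a ^ 2 ^ k‖ ≤ l ^ 2 ^ k := fun k =>
    (norm_pow_le' _ (by positivity)).trans (pow_le_pow_left₀ (norm_nonneg _) ha _)
  have htl : ∀ k : ℕ, ‖a.fst ^ 2 ^ k‖ ≤ l ^ 2 ^ k := fun k => by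
    rw [norm_pow]
    exact pow_le_pow_left₀ (norm_nonneg _) hat _
  have hx : ∀ k, ‖H (k + 1)‖ ≤ 4 * K * (‖H k‖ ^ (2 - δ / (δ + κ)) *
      ‖toL2 (H k)‖ ^ (δ / (δ + κ))) + 2 * l ^ 2 ^ k * ‖H k‖ := by
    intro k
    rw [hH]
    refine (norm_add_le _ _).trans (add_le_add (h.norm_mul_self_le_rpow hp (H k)) ?_)
    rw [norm_smul, norm_mul, Complex.norm_ofNat]
    exact mul_le_mul_of_nonneg_right (mul_le_mul_of_nonneg_left (htl k) zero_le_two)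
      (norm_nonneg _)
  have hy : ∀ k, ‖toL2 (H (k + 1))‖ ≤ 2 * l ^ 2 ^ k * ‖toL2 (H k)‖ := by
    intro k
    -- One factor H_k is regarded as a vector and the other is absorbed into the operator
    -- Φ(a)^(2^k), whose norm is at most l^(2^k).
    have h1 : toL2 (H (k + 1)) =
        (h.unitizationOp a ^ 2 ^ k) (toL2 (H k)) + a.fst ^ 2 ^ k • toL2 (H k) := by
      rw [hH, map_add, map_smul, hpow, add_apply, h.leftOp_apply_toL2 hp,
        smul_apply, one_apply_eq_self, two_mul, add_smul, add_assoc]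
    rw [h1, two_mul, add_mul]
    refine (norm_add_le _ _).trans (add_le_add ?_ ?_)
    · exact (ContinuousLinearMap.le_opNorm _ _).trans
        (mul_le_mul_of_nonneg_right (hpl k) (norm_nonneg _))
    · rw [norm_smul]
      exact mul_le_mul_of_nonneg_right (htl k) (norm_nonneg _)
  have hlim := tendsto_zero_of_differential_inequality (x := fun k => ‖H k‖)
    (y := fun k => ‖toL2 (H k)‖) hl0 hl1 (θ := δ / (δ + κ)) (C := 4 * K) (by positivity)
    ((div_le_one (by positivity)).2 (by linarith)) (by positivity) (fun k => norm_nonneg _)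
    (fun k => norm_nonneg _) hx hy
  have hlim2 : Tendsto (fun k : ℕ => l ^ 2 ^ k) atTop (𝓝 0) :=
    (tendsto_pow_atTop_nhds_zero_of_lt_one hl0.le hl1).comp
      (tendsto_pow_atTop_atTop_of_one_lt one_lt_two)
  have hlim3 := (hlim.const_mul (2 * K)).add hlim2
  rw [mul_zero, add_zero] at hlim3
  obtain ⟨k, hk⟩ := (hlim3.eventually (gt_mem_nhds one_pos)).exists
  exact ⟨2 ^ k, H k, a.fst ^ 2 ^ k, hpow k, (add_le_add_right (htl k) _).trans_lt hk⟩

/-- The image of the unitization of `Lᵖ(ω) ∩ L²` is inverse-closed. -/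
theorem exists_unitizationOp_eq_inverse (hp : p ≠ ∞) (hG : ¬DiscreteTopology G)
    (a : Unitization ℂ (WeightedLpL2 ω p μ)) {S : Lp ℂ 2 μ →L[ℂ] Lp ℂ 2 μ}
    (hS : h.unitizationOp a * S = 1) (hS' : S * h.unitizationOp a = 1) :
    ∃ b, h.unitizationOp b = S := by
  obtain ⟨c, l, -, hl0, hl1, hle⟩ := exists_norm_one_sub_smul_mul_adjoint_le hS
  obtain ⟨a', ha'⟩ := h.exists_unitizationOp_eq_adjoint a
  set y : Unitization ℂ (WeightedLpL2 ω p μ) := 1 + (-(c : ℂ)) • (a * a') with hy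
  have hyY : h.unitizationOp y = 1 - (c : ℂ) • (h.unitizationOp a * h.unitizationOp a') := by
    rw [hy, map_add, map_smul, h.unitizationOp_one, h.unitizationOp_mul hp, neg_smul,
      ← sub_eq_add_neg]
  rw [← ha', ← hyY] at hle
  obtain ⟨n, d, t, hpow, hsmall⟩ := h.exists_pow_eq_small hp hG y hl0 hl1 hle
  obtain ⟨e, he⟩ := h.exists_one_sub_mul_eq_one hp d t hsmall
  choose z hz using h.exists_unitizationOp_eq_pow hp y
  have hsum : h.unitizationOp (∑ i ∈ Finset.range n, z i) =
      ∑ i ∈ Finset.range n, h.unitizationOp y ^ i := by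
    rw [map_sum]
    exact Finset.sum_congr rfl fun i _ => hz i
  have hright : h.unitizationOp a *
      -- With X = Φ(a) and Y = 1 - cXX*, the geometric sum gives cXX* (1 + Y + ⋯ + Y^(n-1)) = 1 -
      -- Y^n, and e represents a right inverse of 1 - Y^n.
      h.unitizationOp ((c : ℂ) • (a' * ((∑ i ∈ Finset.range n, z i) * e))) = 1 := by
    rw [map_smul, h.unitizationOp_mul hp, h.unitizationOp_mul hp, hsum, mul_smul_comm,
      ← mul_assoc, ← smul_mul_assoc, ← mul_assoc]
    have h1 : (c : ℂ) • (h.unitizationOp a * h.unitizationOp a') = 1 - h.unitizationOp y := by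
      rw [hyY, sub_sub_cancel]
    rw [h1, mul_neg_geom_sum, hpow, he]
  -- A right inverse of an operator with left inverse S equals S.
  refine ⟨(c : ℂ) • (a' * ((∑ i ∈ Finset.range n, z i) * e)), ?_⟩
  rw [← one_mul (h.unitizationOp _), ← hS', mul_assoc, hright, mul_one]

end IsDifferentialWeight

/-! ### The theorem -/

theorem corollary5p7 {G : Type*} [Group G] [TopologicalSpace G] [IsTopologicalGroup G]
    [LocallyCompactSpace G] [T2Space G] [MeasurableSpace G] [BorelSpace G]
    (hG : ¬ DiscreteTopology G)
    (μ : Measure G) [μ.IsHaarMeasure] [μ.Regular]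
    (ω : G → ℝ) (hω : IsWeight ω)
    (p q : ℝ≥0∞) [Fact (1 ≤ p)] (hp : p ≠ ∞) (hpq : ENNReal.HolderConjugate p q)
    (u : G → ℝ) (hu_meas : Measurable u) (hu_nonneg : ∀ x, 0 ≤ u x) (hu_bdd : ∃ M, ∀ x, u x ≤ M)
    (s r : ℝ) (hs : ENNReal.ofReal s < q) (hr : 0 < r)
    (hσ : ∃ c > 0, ∀ x, c ≤ ω x * u x)
    (hωu : ∀ x y, ω (x * y) / (ω x * ω y) ≤ u x + u y)
    (hint : Integrable (fun x => u x ^ s * ω x ^ r) μ) :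
    -- `A` is a Banach algebra under convolution
    CompleteSpace (WeightedLpL2 ω p μ) ∧
    (∀ f g : WeightedLpL2 ω p μ, IsConvolution μ f.toL2 g.toL2 (f * g).toL2) ∧
    (∃ C : ℝ, ∀ f g : WeightedLpL2 ω p μ, ‖f * g‖ ≤ C * ‖f‖ * ‖g‖) ∧
    -- the natural map `(f, t) ↦ (g ↦ f * g + t g)` from the unitization of `A` to `B(L²(G))`
    ∃ Φ : Unitization ℂ (WeightedLpL2 ω p μ) →ₗ[ℂ] (Lp ℂ 2 μ →L[ℂ] Lp ℂ 2 μ),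
      (∀ (a : Unitization ℂ (WeightedLpL2 ω p μ)) (g : Lp ℂ 2 μ),
        ∃ k : Lp ℂ 2 μ, IsConvolution μ a.snd.toL2 g k ∧ Φ a g = k + a.fst • g) ∧
      -- is a unital homomorphism of algebras, continuous and injective
      Φ 1 = 1 ∧
      (∀ a b, Φ (a * b) = Φ a * Φ b) ∧
      (∃ C : ℝ, ∀ a, ‖Φ a‖ ≤ C * unitizationNorm a) ∧
      Function.Injective Φ ∧
      -- and its image is inverse-closed
      (∀ (a : Unitization ℂ (WeightedLpL2 ω p μ)) (S : Lp ℂ 2 μ →L[ℂ] Lp ℂ 2 μ),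
        Φ a * S = 1 → S * Φ a = 1 → ∃ b, Φ b = S) := by
  obtain ⟨M, hM⟩ := hu_bdd
  obtain ⟨c, hc, hcu⟩ := hσ
  have hω0 : ∀ x, 0 < ω x := fun x => one_pos.trans_le (hω.one_le x)
  have hu0 : ∀ x, 0 < u x := fun x =>
    (mul_pos_iff_of_pos_left (hω0 x)).1 (hc.trans_le (hcu x))
  have hM0 : 0 < M := (hu0 1).trans_le (hM 1)
  -- The exponent s, which may even be negative, is replaced by max(s, 1). This stays below q
  -- because p < ∞ forces q > 1, and integrability survives because u is bounded.
  have hq : ENNReal.ofReal (max s 1) < q := by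
    rw [ENNReal.ofReal_max, ENNReal.ofReal_one]
    refine max_lt hs (lt_of_le_of_ne hpq.symm.one_le fun h1 => hp ?_)
    have h2 := hpq.inv_add_inv_eq_one
    rw [← h1, inv_one] at h2
    have h3 : p⁻¹ = 0 := by
      have h4 : p⁻¹ + 1 = 0 + 1 := by rw [h2, zero_add]
      exact (ENNReal.add_left_inj ENNReal.one_ne_top).1 h4
    exact ENNReal.inv_eq_zero.1 h3
  have hint' : Integrable (fun x => u x ^ max s 1 * ω x ^ r) μ := by
    refine (hint.const_mul (M ^ (max s 1 - s))).mono'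
      ((hu_meas.pow_const _).mul (hω.measurable.pow_const _)).aestronglyMeasurable
      (ae_of_all _ fun x => ?_)
    have hux := hu0 x
    have hωx := hω0 x
    rw [Real.norm_of_nonneg (by positivity), ← mul_assoc]
    refine mul_le_mul_of_nonneg_right ?_ (by positivity)
    calc u x ^ max s 1 = u x ^ (max s 1 - s) * u x ^ s := by
          rw [← Real.rpow_add hux, sub_add_cancel]
      _ ≤ M ^ (max s 1 - s) * u x ^ s := mul_le_mul_of_nonneg_right
          (Real.rpow_le_rpow hux.le (hM x) (sub_nonneg.2 (le_max_left _ _))) (by positivity)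
  have hcw : IsControlledWeight μ ω u (max s 1) r c M :=
    { isWeight := hω
      measurable_bound := hu_meas
      c_pos := hc
      le_mul := hcu
      bound_le := hM
      one_le_s := le_max_right _ _
      r_pos := hr
      map_mul_le := fun x y => by
        have h1 := hωu x y
        rw [div_le_iff₀ (mul_pos (hω0 x) (hω0 y))] at h1
        rwa [mul_comm] at h1
      integrable := hint' }
  have := hcw.sigmaCompactSpace
  have := hcw.isInvInvariant
  obtain ⟨U, K, δ, κ, h⟩ := hcw.exists_isDifferentialWeight hpq hq
  refine ⟨WeightedLpL2.completeSpace, h.isConvolution_mul hp, ⟨2 * K, h.norm_mul_le hp⟩,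
    h.unitizationOp, fun a g => ⟨h.leftOp a.snd g, ⟨?_, h.coeFn_leftOp a.snd g⟩, ?_⟩,
    h.unitizationOp_one, h.unitizationOp_mul hp, ⟨_, h.norm_unitizationOp_le⟩,
    h.unitizationOp_injective hG, fun a S h1 h2 => h.exists_unitizationOp_eq_inverse hp hG a h1 h2⟩
  · exact (isConvolution_groupConv μ (h.memLp_one a.snd) one_le_two ENNReal.ofNat_ne_top
      (Lp.memLp g)).1
  · simp [h.unitizationOp_apply]
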